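/- Let $q\in\mathbb{C}$ with $0<|q|<1$. Write $(x;q)_\infty=\prod_{i\ge 0}(1-q^ix)$, $j(x;q)=(x;q)_\infty(q/x;q)_\infty(q;q)_\infty$, $J_m=\prod_{i\ge1}(1-q^{mi})$, and define the Appell–Lerch function $$m(x,q,z)=\frac{1}{j(z;q)}\sum_{r\in\mathbb{Z}}\frac{(-1)^rq^{\binom r2}z^r}{1-q^{r-1}xz}.$$ Let $x,y,z\in\mathbb{C}$ with $|q|<|x|<1$, $|q|<|y|<1$, $|q|<|z|<1$. Then the two triple series below converge absolutely, and if none of $xy$, $xz$, $yz$ equals $q$, $$\begin{aligned} \Big(\sum_{r,s,t\ge0}+\sum_{r,s,t<0}\Big)q^{rs+rt+st}x^ry^sz^t &=\frac{J_1^3\,j(yz;q)}{j(y;q)j(z;q)}\,m\Big(-\frac{qx}{yz},q^2,qyz\Big) +\frac{J_1^3\,j(xy;q)}{j(x;q)j(y;q)}\,m\Big(-\frac{qz}{xy},q^2,qxy\Big)\\ &\quad+\frac{J_1^3\,j(xz;q)}{j(x;q)j(z;q)}\,m\Big(-\frac{qy}{xz},q^2,qxz\Big)\\ &\quad-2\,\frac{J_1^3J_2^3}{j(x;q)j(y;q)j(z;q)}\cdot\frac{j(xy;q^2)j(xz;q^2)j(yz;q^2)}{j(-x;q^2)j(-y;q^2)j(-z;q^2)}.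 \end{aligned}$$ If one of $xy$, $xz$, $yz$ equals $q$, the right-hand side has a removable singularity at $(x,y,z)$ and the identity holds with the right-hand side replaced by its limit at $(x,y,z)$, taken over the points $(x',y',z')$ with $x'y',x'z',y'z'\ne q$. -/

import Mathlib

open Filter Topology

noncomputable section

namespace HeckeTriple

/-- The infinite `q`-Pochhammer symbol `(x; q)_∞ = ∏_{i ≥ 0} (1 - q^i x)`. -/
def qPoch (x q : ℂ) : ℂ := ∏' i : ℕ, (1 - q ^ i * x)

/-- The theta function `j(x; q) = (x; q)_∞ (q/x; q)_∞ (q; q)_∞`. -/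
def j (x q : ℂ) : ℂ := qPoch x q * qPoch (q / x) q * qPoch q q

/-- `J_m = ∏_{i ≥ 1} (1 - q^{m i}) = (q^m; q^m)_∞`. -/
def J (m : ℕ) (q : ℂ) : ℂ := qPoch (q ^ m) (q ^ m)

/-- The Appell–Lerch function
`m(x, q, z) = j(z; q)⁻¹ ∑_{r ∈ ℤ} (-1)^r q^{r(r-1)/2} z^r / (1 - q^{r-1} x z)`. -/
def m (x q z : ℂ) : ℂ :=
  1 / j z q *
    ∑' r : ℤ, (-1) ^ r * q ^ (r * (r - 1) / 2) * z ^ r / (1 - q ^ (r - 1) * x * z)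

/-- The summand `q^{rs+rt+st} x^r y^s z^t`, with `p = (r, s, t)`. -/
def term (q x y z : ℂ) (p : ℤ × ℤ × ℤ) : ℂ :=
  q ^ (p.1 * p.2.1 + p.1 * p.2.2 + p.2.1 * p.2.2) * x ^ p.1 * y ^ p.2.1 * z ^ p.2.2

/-- The triples `(r, s, t)` with `r, s, t ≥ 0`. -/
def nonnegTriples : Set (ℤ × ℤ × ℤ) := {p | 0 ≤ p.1 ∧ 0 ≤ p.2.1 ∧ 0 ≤ p.2.2}

/-- The triples `(r, s, t)` with `r, s, t < 0`. -/
def negTriples : Set (ℤ × ℤ × ℤ) := {p | p.1 < 0 ∧ p.2.1 < 0 ∧ p.2.2 < 0}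

/-- `(∑_{r,s,t ≥ 0} + ∑_{r,s,t < 0}) q^{rs+rt+st} x^r y^s z^t`. -/
def tripleSum (q x y z : ℂ) : ℂ :=
  (∑' p : nonnegTriples, term q x y z p) + ∑' p : negTriples, term q x y z p

/-- The expression of the triple sum through Appell–Lerch and theta functions. -/
def appellLerchSide (q x y z : ℂ) : ℂ :=
  J 1 q ^ 3 * j (y * z) q / (j y q * j z q) * m (-(q * x / (y * z))) (q ^ 2) (q * y * z)
  + J 1 q ^ 3 * j (x * y) q / (j x q * j y q) * m (-(q * z / (x * y))) (q ^ 2) (q * x * y)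
  - 2 * (J 1 q ^ 3 * J 2 q ^ 3 / (j x q * j y q * j z q))
    * (j (x * y) (q ^ 2) * j (x * z) (q ^ 2) * j (y * z) (q ^ 2)
      / (j (-x) (q ^ 2) * j (-y) (q ^ 2) * j (-z) (q ^ 2)))
  + J 1 q ^ 3 * j (x * z) q / (j x q * j z q) * m (-(q * y / (x * z))) (q ^ 2) (q * x * z)

/-- The points `(x, y, z)` with `xy, xz, yz ≠ q`. For `|q| < |x|, |y|, |z| < 1` these are exactly
the points at which every denominator in `appellLerchSide` is nonzero: `j(qyz; q²) = 0` only
for `yz = q`, and likewise for the other two pairs. -/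
def regularPoints (q : ℂ) : Set (ℂ × ℂ × ℂ) :=
  {p | p.1 * p.2.1 ≠ q ∧ p.1 * p.2.2 ≠ q ∧ p.2.1 * p.2.2 ≠ q}

end HeckeTriple

end

/-!
Both sides, multiplied by `j(x; q) j(y; q) j(z; q)`, differ by a function `D(x, y, z)`, which is
symmetric. Summing one geometric series continues the triple sum meromorphically in `z` beyond the
unit circle, and in `D` the poles at `z = 1` and `z = -1` cancel. Moreover
`D(x, y, q²z) = (xyz)⁻¹ D(x, y, z)`. By comparison of Laurent coefficients, the holomorphic
functions on an annulus with `f(pz) = c z⁻¹ f(z)` form a space of dimension at most one, so that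
`D(x, y, z)` is a multiple of `j(-xyz; q²)` in each of its variables. As `j(q; q) = 0`, every term
of `D(q, y, q)` vanishes; hence `D = 0`.

The same uniqueness principle gives the Jacobi triple product, normalized by the pentagonal number
theorem, and Kronecker's identity for `∑ q^{rs} x^r y^s`, from which the behaviour of `D` under
`z ↦ q²z` follows.
-/

noncomputable section

namespace HeckeTriple

variable {q : ℂ}

/-! ### Quasi-periodic functions on annuli -/

/-- The open annulus `a < ‖z‖ < b` around the origin. -/
def annulus (a b : ℝ) : Set ℂ := {z | a < ‖z‖ ∧ ‖z‖ < b}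

lemma isOpen_annulus (a b : ℝ) : IsOpen (annulus a b) :=
  (isOpen_lt continuous_const continuous_norm).inter (isOpen_lt continuous_norm continuous_const)

lemma ne_zero_of_mem_annulus {a b : ℝ} (ha : 0 ≤ a) {z : ℂ} (hz : z ∈ annulus a b) : z ≠ 0 :=
  norm_pos_iff.mp (ha.trans_lt hz.1)

lemma sphere_subset_annulus {a b r : ℝ} (har : a < r) (hrb : r < b) :
    Metric.sphere 0 r ⊆ annulus a b := fun z hz ↦ by
  rw [mem_sphere_zero_iff_norm] at hz
  exact ⟨hz ▸ har, hz ▸ hrb⟩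

lemma circleIntegral_norm_mul {E : Type*} [NormedAddCommGroup E] [NormedSpace ℂ E] (f : ℂ → E)
    (p : ℂ) (r : ℝ) : (∮ z in C(0, ‖p‖ * r), f z) = p • ∮ z in C(0, r), f (p * z) := by
  have circleMap_add_arg : ∀ θ : ℝ,
      circleMap 0 (‖p‖ * r) (θ + p.arg) = p * circleMap 0 r θ := fun θ ↦ by
    simp only [circleMap, zero_add]
    nth_rw 3 [← Complex.norm_mul_exp_arg_mul_I p]
    push_cast
    rw [add_mul, Complex.exp_add]
    ring
  set F : ℝ → E := fun θ ↦ deriv (circleMap 0 (‖p‖ * r)) θ • f (circleMap 0 (‖p‖ * r) θ) with hF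
  have hper : Function.Periodic F (2 * Real.pi) := fun θ ↦ by
    simp only [hF, deriv_circleMap, periodic_circleMap 0 (‖p‖ * r) θ]
  have rotate : ∫ θ in (0 : ℝ)..2 * Real.pi, F θ
      = ∫ θ in (0 : ℝ)..2 * Real.pi, F (θ + p.arg) := by
    rw [intervalIntegral.integral_comp_add_right, zero_add, add_comm (2 * Real.pi)]
    simpa using hper.intervalIntegral_add_eq 0 p.arg
  rw [circleIntegral, circleIntegral, rotate, ← intervalIntegral.integral_smul]
  refine intervalIntegral.integral_congr fun θ _ ↦ ?_
  simp only [hF, deriv_circleMap, circleMap_add_arg, smul_smul]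
  ring_nf

/-- The `n`-th coefficient of the Laurent expansion of `f` on the circle of radius `r` around the
origin. -/
def laurentCoeff (f : ℂ → ℂ) (r : ℝ) (n : ℤ) : ℂ :=
  (2 * Real.pi * Complex.I)⁻¹ * ∮ z in C(0, r), z ^ (-n - 1) * f z

lemma fourier_two_pi_coe (n : ℤ) (θ : ℝ) :
    fourier n (θ : AddCircle (2 * Real.pi)) = circleMap 0 1 θ ^ n := by
  have hπ : (Real.pi : ℂ) ≠ 0 := mod_cast Real.pi_ne_zero
  rw [fourier_coe_apply, circleMap, zero_add, Complex.ofReal_one, one_mul, ← Complex.exp_int_mul]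
  congr 1
  push_cast
  field_simp

lemma fourierCoeff_circle [Fact (0 < 2 * Real.pi)] (f : ℂ → ℂ) {r : ℝ} (hr : r ≠ 0) (n : ℤ) :
    fourierCoeff (fun t : AddCircle (2 * Real.pi) ↦ f (r * AddCircle.toCircle t)) n
      = r ^ n * laurentCoeff f r n := by
  have hr' : (r : ℂ) ≠ 0 := mod_cast hr
  rw [fourierCoeff_eq_intervalIntegral _ n 0, laurentCoeff, circleIntegral, zero_add,
    ← mul_assoc, ← intervalIntegral.integral_const_mul, ← intervalIntegral.integral_smul]
  refine intervalIntegral.integral_congr fun θ _ ↦ ?_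
  have hθ : circleMap 0 r θ = r * circleMap 0 1 θ := by simp [circleMap]
  have htoCircle : (AddCircle.toCircle (θ : AddCircle (2 * Real.pi)) : ℂ) = circleMap 0 1 θ := by
    simpa using fourier_two_pi_coe 1 θ
  have hne : circleMap 0 1 θ ≠ 0 := circleMap_ne_center one_ne_zero
  rw [htoCircle, ← hθ, fourier_two_pi_coe, deriv_circleMap, hθ, zpow_sub_one₀ (by positivity),
    mul_zpow, zpow_neg (r : ℂ)]
  simp only [smul_eq_mul, Complex.real_smul]
  push_cast
  field_simp

lemma eqOn_zero_of_laurentCoeff_eq_zero {f : ℂ → ℂ} {r : ℝ} (hr : 0 < r)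
    (hf : ContinuousOn f (Metric.sphere 0 r)) (hcoeff : ∀ n, laurentCoeff f r n = 0) :
    Set.EqOn f 0 (Metric.sphere 0 r) := by
  have : Fact (0 < 2 * Real.pi) := ⟨Real.two_pi_pos⟩
  let g : C(AddCircle (2 * Real.pi), ℂ) :=
    ⟨fun t ↦ f (r * AddCircle.toCircle t), hf.comp_continuous
      (continuous_const.mul (continuous_subtype_val.comp AddCircle.continuous_toCircle))
      fun t ↦ by simp [abs_of_pos hr, Circle.norm_coe]⟩
  have hg : fourierCoeff g = 0 := funext fun n ↦ by
    rw [Pi.zero_apply, ← mul_zero ((r : ℂ) ^ n), ← hcoeff n]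
    exact fourierCoeff_circle f hr.ne' n
  have hg0 : g = 0 := by
    refine (hasSum_fourier_series_of_summable (by rw [hg]; exact summable_zero)).unique ?_
    simp [hg, hasSum_zero]
  intro z hz
  rw [mem_sphere_zero_iff_norm] at hz
  have htoCircle : (r : ℂ) * AddCircle.toCircle (z.arg : AddCircle (2 * Real.pi)) = z := by
    rw [AddCircle.toCircle_apply_mk, div_self Real.two_pi_pos.ne', one_mul, Circle.coe_exp, ← hz,
      Complex.norm_mul_exp_arg_mul_I]
  have hgz := DFunLike.congr_fun hg0 (z.arg : AddCircle (2 * Real.pi))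
  rwa [ContinuousMap.coe_mk, htoCircle] at hgz

lemma circleIntegral_eq_of_differentiableOn_annulus {E : Type*} [NormedAddCommGroup E]
    [NormedSpace ℂ E] {a b r s : ℝ} (ha : 0 ≤ a) {f : ℂ → E}
    (hf : DifferentiableOn ℂ f (annulus a b)) (hr : r ∈ Set.Ioo a b) (hs : s ∈ Set.Ioo a b) :
    (∮ z in C(0, r), f z) = ∮ z in C(0, s), f z := by
  wlog hle : s ≤ r generalizing r s
  · exact (this hs hr (le_of_not_ge hle)).symm
  refine Complex.circleIntegral_eq_of_differentiable_on_annulus_off_countable (ha.trans_lt hs.1)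
    hle Set.countable_empty (hf.continuousOn.mono fun z hz ↦ ?_) fun z hz ↦ ?_
  · simp only [Set.mem_sdiff, Metric.mem_closedBall, dist_zero_right, Metric.mem_ball, not_lt] at hz
    exact ⟨hs.1.trans_le hz.2, hz.1.trans_lt hr.2⟩
  · simp only [Set.mem_sdiff, Metric.mem_closedBall, dist_zero_right, Metric.mem_ball, not_le,
      Set.mem_empty_iff_false, not_false_eq_true, and_true] at hz
    exact hf.differentiableAt
      ((isOpen_annulus a b).mem_nhds ⟨hs.1.trans hz.2, hz.1.trans hr.2⟩)

lemma differentiableOn_zpow_mul {a b : ℝ} (ha : 0 ≤ a) {f : ℂ → ℂ}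
    (hf : DifferentiableOn ℂ f (annulus a b)) (n : ℤ) :
    DifferentiableOn ℂ (fun z ↦ z ^ n * f z) (annulus a b) :=
  DifferentiableOn.mul (fun _ hz ↦ (differentiableAt_zpow.mpr
    (Or.inl (ne_zero_of_mem_annulus ha hz))).differentiableWithinAt) hf

lemma laurentCoeff_eq_of_differentiableOn_annulus {a b r s : ℝ} (ha : 0 ≤ a) {f : ℂ → ℂ}
    (hf : DifferentiableOn ℂ f (annulus a b)) (hr : r ∈ Set.Ioo a b) (hs : s ∈ Set.Ioo a b)
    (n : ℤ) : laurentCoeff f r n = laurentCoeff f s n := by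
  rw [laurentCoeff, circleIntegral_eq_of_differentiableOn_annulus ha
    (differentiableOn_zpow_mul ha hf _) hr hs, laurentCoeff]

lemma laurentCoeff_smul_sub_smul {a b r : ℝ} (ha : 0 ≤ a) {f g : ℂ → ℂ}
    (hf : DifferentiableOn ℂ f (annulus a b)) (hg : DifferentiableOn ℂ g (annulus a b))
    (hr : r ∈ Set.Ioo a b) (c d : ℂ) (n : ℤ) :
    laurentCoeff (c • f - d • g) r n = c * laurentCoeff f r n - d * laurentCoeff g r n := by
  have integrable : ∀ {h : ℂ → ℂ}, DifferentiableOn ℂ h (annulus a b) →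
      CircleIntegrable (fun z ↦ z ^ (-n - 1) * h z) 0 r := fun hh ↦
    ((differentiableOn_zpow_mul ha hh _).continuousOn.mono
      (sphere_subset_annulus hr.1 hr.2)).circleIntegrable (ha.trans hr.1.le)
  have hdistrib : ∀ z, z ^ (-n - 1) * (c • f - d • g) z
      = c • (z ^ (-n - 1) * f z) - d • (z ^ (-n - 1) * g z) := fun z ↦ by
    simp only [Pi.sub_apply, Pi.smul_apply, smul_eq_mul]
    ring
  simp only [laurentCoeff, hdistrib]
  rw [circleIntegral.integral_sub (integrable hf).const_fun_smul (integrable hg).const_fun_smul,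
    circleIntegral.integral_smul, circleIntegral.integral_smul, smul_eq_mul, smul_eq_mul]
  ring

lemma laurentCoeff_succ_of_quasiPeriodic {a b r : ℝ} (ha : 0 ≤ a) {p c : ℂ} (hp : ‖p‖ ≤ 1)
    {f : ℂ → ℂ} (hf : DifferentiableOn ℂ f (annulus a b)) (har : a < ‖p‖ * r) (hrb : r < b)
    (hper : ∀ z : ℂ, ‖z‖ = r → f (p * z) = c * z⁻¹ * f z) (n : ℤ) :
    c * laurentCoeff f r (n + 1) = p ^ n * laurentCoeff f r n := by
  have hr : 0 < r := pos_of_mul_pos_right (ha.trans_lt har) (norm_nonneg p)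
  have hp0 : p ≠ 0 := norm_pos_iff.mp (pos_of_mul_pos_left (ha.trans_lt har) hr.le)
  have hpr : ‖p‖ * r ≤ r := mul_le_of_le_one_left hr.le hp
  rw [laurentCoeff_eq_of_differentiableOn_annulus ha hf ⟨har.trans_le hpr, hrb⟩
    ⟨har, hpr.trans_lt hrb⟩ n, laurentCoeff, laurentCoeff, circleIntegral_norm_mul, smul_eq_mul,
    mul_left_comm, mul_left_comm (p ^ n), ← mul_assoc (p ^ n)]
  congr 1
  rw [← circleIntegral.integral_const_mul, ← circleIntegral.integral_const_mul]
  refine circleIntegral.integral_congr hr.le fun z hz ↦ ?_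
  rw [mem_sphere_zero_iff_norm] at hz
  have hz0 : z ≠ 0 := norm_pos_iff.mp (hz ▸ hr)
  rw [hper z hz, mul_zpow, neg_add, zpow_sub_one₀ hp0, zpow_sub_one₀ hz0, zpow_sub_one₀ hz0,
    zpow_add₀ hz0, zpow_neg_one, zpow_neg p]
  field_simp

lemma eqOn_zero_of_quasiPeriodic {a b r : ℝ} (ha : 0 ≤ a) {p c : ℂ} (hp : ‖p‖ ≤ 1) (hc : c ≠ 0)
    {f : ℂ → ℂ} (hf : DifferentiableOn ℂ f (annulus a b)) (har : a < ‖p‖ * r) (hrb : r < b)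
    (hper : ∀ z : ℂ, ‖z‖ = r → f (p * z) = c * z⁻¹ * f z) (h0 : laurentCoeff f r 0 = 0) :
    Set.EqOn f 0 (annulus a b) := by
  have hr : 0 < r := pos_of_mul_pos_right (ha.trans_lt har) (norm_nonneg p)
  have hp0 : p ≠ 0 := norm_pos_iff.mp (pos_of_mul_pos_left (ha.trans_lt har) hr.le)
  have har' : a < r := har.trans_le (mul_le_of_le_one_left hr.le hp)
  have hcoeff : ∀ n, laurentCoeff f r n = 0 := fun n ↦ by
    have hsucc := laurentCoeff_succ_of_quasiPeriodic ha hp hf har hrb hper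
    induction n using Int.induction_on with
    | zero => exact h0
    | succ k ih => simpa [ih, hc] using hsucc k
    | pred k ih =>
      have := hsucc (-k - 1)
      rw [sub_add_cancel, ih, mul_zero, eq_comm, mul_eq_zero] at this
      exact this.resolve_left (zpow_ne_zero _ hp0)
  intro z hz
  refine eqOn_zero_of_laurentCoeff_eq_zero (ha.trans_lt hz.1)
    (hf.continuousOn.mono (sphere_subset_annulus hz.1 hz.2)) (fun n ↦ ?_)
    (mem_sphere_zero_iff_norm.mpr rfl)
  rw [laurentCoeff_eq_of_differentiableOn_annulus ha hf hz ⟨har', hrb⟩, hcoeff]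

/-- All Laurent coefficients of `f` and `g` are determined by the constant one. -/
lemma mul_eq_mul_of_quasiPeriodic {a b r : ℝ} (ha : 0 ≤ a) {p c : ℂ} (hp : ‖p‖ ≤ 1)
    (hc : c ≠ 0) {f g : ℂ → ℂ} (hf : DifferentiableOn ℂ f (annulus a b))
    (hg : DifferentiableOn ℂ g (annulus a b)) (har : a < ‖p‖ * r) (hrb : r < b)
    (hfper : ∀ z : ℂ, ‖z‖ = r → f (p * z) = c * z⁻¹ * f z)
    (hgper : ∀ z : ℂ, ‖z‖ = r → g (p * z) = c * z⁻¹ * g z)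
    {z w : ℂ} (hz : z ∈ annulus a b) (hw : w ∈ annulus a b) : f z * g w = f w * g z := by
  have hr : r ∈ Set.Ioo a b :=
    ⟨har.trans_le (mul_le_of_le_one_left
      (pos_of_mul_pos_right (ha.trans_lt har) (norm_nonneg p)).le hp), hrb⟩
  set A := laurentCoeff f r 0
  set B := laurentCoeff g r 0
  have hcomb : Set.EqOn (B • f - A • g) 0 (annulus a b) := by
    refine eqOn_zero_of_quasiPeriodic ha hp hc ((hf.const_smul B).sub (hg.const_smul A)) har hrb
      (fun u hu ↦ ?_) ?_
    · simp only [Pi.sub_apply, Pi.smul_apply, smul_eq_mul, hfper u hu, hgper u hu]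
      ring
    · rw [laurentCoeff_smul_sub_smul ha hf hg hr, mul_comm, sub_self]
  by_cases hA : A = 0
  · have hf0 := eqOn_zero_of_quasiPeriodic ha hp hc hf har hrb hfper hA
    simp [hf0 hz, hf0 hw]
  · have hz' : B * f z - A * g z = 0 := hcomb hz
    have hw' : B * f w - A * g w = 0 := hcomb hw
    exact mul_left_cancel₀ hA (by linear_combination f w * hz' - f z * hw')

/-! ### Theta functions -/

lemma neg_mem_annulus {a b : ℝ} {z : ℂ} : -z ∈ annulus a b ↔ z ∈ annulus a b := by
  simp only [annulus, Set.mem_ofPred_eq, norm_neg]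

lemma norm_div_lt_one {p z : ℂ} (hz : ‖p‖ < ‖z‖) : ‖p / z‖ < 1 := by
  rwa [norm_div, div_lt_one ((norm_nonneg p).trans_lt hz)]

lemma norm_mul_lt_one_of_norm_lt_inv {p z : ℂ} (hz : ‖z‖ < ‖p‖⁻¹) : ‖p * z‖ < 1 := by
  have hp : 0 < ‖p‖ := inv_pos.mp ((norm_nonneg z).trans_lt hz)
  rw [norm_mul, ← mul_inv_cancel₀ hp.ne']
  exact mul_lt_mul_of_pos_left hz hp

lemma norm_pow_lt_one (hq : ‖q‖ < 1) {n : ℕ} (hn : n ≠ 0) : ‖q ^ n‖ < 1 := by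
  rw [norm_pow]
  exact pow_lt_one₀ (norm_nonneg q) hq hn

lemma annulus_subset_annulus_sq (hq : ‖q‖ ≤ 1) : annulus ‖q‖ 1 ⊆ annulus ‖q ^ 2‖ 1 :=
  fun _ hz ↦ ⟨(norm_pow q 2 ▸ pow_le_of_le_one (norm_nonneg q) hq two_ne_zero).trans_lt hz.1, hz.2⟩

lemma mul_mem_annulus_sq {x y : ℂ} (hx : x ∈ annulus ‖q‖ 1) (hy : y ∈ annulus ‖q‖ 1) :
    x * y ∈ annulus ‖q ^ 2‖ 1 := by
  refine ⟨?_, ?_⟩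
  · rw [norm_pow, norm_mul, sq]
    exact mul_lt_mul'' hx.1 hy.1 (norm_nonneg q) (norm_nonneg q)
  · rw [norm_mul]
    exact mul_lt_one_of_nonneg_of_lt_one_left (norm_nonneg x) hx.2 hy.2.le

lemma summable_norm_qPoch (hq : ‖q‖ < 1) (x : ℂ) : Summable fun i : ℕ ↦ ‖-(q ^ i * x)‖ := by
  simp only [norm_neg, norm_mul, norm_pow]
  exact (summable_geometric_of_lt_one (norm_nonneg q) hq).mul_right _

lemma multipliable_qPoch (hq : ‖q‖ < 1) (x : ℂ) : Multipliable fun i : ℕ ↦ 1 - q ^ i * x := by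
  simpa only [sub_eq_add_neg] using multipliable_one_add_of_summable (summable_norm_qPoch hq x)

lemma tendsto_prod_qPoch (hq : ‖q‖ < 1) (x : ℂ) :
    Tendsto (fun n ↦ ∏ i ∈ Finset.range n, (1 - q ^ i * x)) atTop (𝓝 (qPoch x q)) :=
  (multipliable_qPoch hq x).hasProd.tendsto_prod_nat

lemma qPoch_eq_one_sub_mul (hq : ‖q‖ < 1) (x : ℂ) : qPoch x q = (1 - x) * qPoch (q * x) q := by
  refine tendsto_nhds_unique ((tendsto_prod_qPoch hq x).comp (tendsto_add_atTop_nat 1))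
    (((tendsto_prod_qPoch hq (q * x)).const_mul (1 - x)).congr fun n ↦ ?_)
  simp only [Function.comp_apply, Finset.prod_range_succ', pow_zero, one_mul, pow_succ, mul_assoc,
    mul_comm (1 - x)]

lemma qPoch_one (hq : ‖q‖ < 1) : qPoch 1 q = 0 := by
  rw [qPoch_eq_one_sub_mul hq, sub_self, zero_mul]

lemma qPoch_ne_zero (hq : ‖q‖ < 1) {x : ℂ} (hx : ‖x‖ < 1) : qPoch x q ≠ 0 := by
  have hfactor : ∀ i : ℕ, 1 + -(q ^ i * x) ≠ 0 := fun i h ↦ by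
    have hlt : ‖q ^ i * x‖ < 1 := by
      rw [norm_mul, norm_pow]
      exact mul_lt_one_of_nonneg_of_lt_one_right (pow_le_one₀ (norm_nonneg q) hq.le)
        (norm_nonneg x) hx
    rw [show q ^ i * x = 1 by linear_combination -h, norm_one] at hlt
    exact lt_irrefl _ hlt
  simpa only [qPoch, sub_eq_add_neg] using
    tprod_one_add_ne_zero_of_summable hfactor (summable_norm_qPoch hq x)

lemma differentiable_qPoch (hq : ‖q‖ < 1) : Differentiable ℂ fun x ↦ qPoch x q := by
  intro x
  have hball : IsOpen (Metric.ball (0 : ℂ) (‖x‖ + 1)) := Metric.isOpen_ball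
  have hprod : HasProdLocallyUniformlyOn (fun (i : ℕ) (y : ℂ) ↦ 1 + -(q ^ i * y))
      (fun y ↦ ∏' i : ℕ, (1 + -(q ^ i * y))) (Metric.ball 0 (‖x‖ + 1)) := by
    refine Summable.hasProdLocallyUniformlyOn_nat_one_add (u := fun i ↦ ‖q‖ ^ i * (‖x‖ + 1)) hball
      ((summable_geometric_of_lt_one (norm_nonneg q) hq).mul_right _)
      (Eventually.of_forall fun i y hy ↦ ?_) fun i ↦ by fun_prop
    rw [norm_neg, norm_mul, norm_pow]
    gcongr
    exact (mem_ball_zero_iff.mp hy).le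
  have hdiff := hprod.differentiableOn (Eventually.of_forall fun s ↦ by fun_prop) hball
  simpa only [qPoch, sub_eq_add_neg] using
    hdiff.differentiableAt (hball.mem_nhds (by simp : x ∈ Metric.ball (0 : ℂ) (‖x‖ + 1)))

lemma qPoch_eq_prod_range (hq : ‖q‖ < 1) {n : ℕ} (hn : n ≠ 0) (x : ℂ) :
    qPoch x q = ∏ k ∈ Finset.range n, qPoch (q ^ k * x) (q ^ n) := by
  have hsub := (tendsto_prod_qPoch hq x).comp
    (tendsto_id.const_mul_atTop' (Nat.pos_of_ne_zero hn))
  refine tendsto_nhds_unique hsub ((tendsto_finsetProd _ fun k _ ↦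
    tendsto_prod_qPoch (norm_pow_lt_one hq hn) (q ^ k * x)).congr fun N ↦ ?_)
  simp only [Function.comp_apply, id]
  induction N with
  | zero => simp
  | succ N ih =>
    rw [Nat.mul_succ, Finset.prod_range_add, ← ih, ← Finset.prod_mul_distrib]
    refine Finset.prod_congr rfl fun k _ ↦ ?_
    rw [Finset.prod_range_succ, pow_add, pow_mul]
    ring

lemma qPoch_neg_mul_qPoch (hq : ‖q‖ < 1) (x : ℂ) :
    qPoch (-x) q * qPoch x q = qPoch (x ^ 2) (q ^ 2) := by
  rw [qPoch, qPoch, qPoch, ← (multipliable_qPoch hq (-x)).tprod_mul (multipliable_qPoch hq x)]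
  congr 1
  ext i
  ring

lemma J_ne_zero (hq : ‖q‖ < 1) {n : ℕ} (hn : n ≠ 0) : J n q ≠ 0 :=
  qPoch_ne_zero (norm_pow_lt_one hq hn) (norm_pow_lt_one hq hn)

/-- The quotient `j(x; q) / (1 - x)`, with its removable singularity at `x = 1` filled in. -/
def jDivOneSub (x q : ℂ) : ℂ := qPoch (q * x) q * qPoch (q / x) q * qPoch q q

lemma j_eq_one_sub_mul (hq : ‖q‖ < 1) (x : ℂ) : j x q = (1 - x) * jDivOneSub x q := by
  rw [j, jDivOneSub, qPoch_eq_one_sub_mul hq x]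
  ring

lemma jDivOneSub_one : jDivOneSub 1 q = J 1 q ^ 3 := by
  simp only [jDivOneSub, J, mul_one, div_one, pow_one]
  ring

lemma j_self (hq : ‖q‖ < 1) (hq0 : q ≠ 0) : j q q = 0 := by
  rw [j, div_self hq0, qPoch_one hq, mul_zero, zero_mul]

lemma j_base_mul (hq : ‖q‖ < 1) (hq0 : q ≠ 0) {x : ℂ} (hx : x ≠ 0) :
    j (q * x) q = -x⁻¹ * j x q := by
  have hinv : qPoch (q / (q * x)) q = (1 - x⁻¹) * qPoch (q / x) q := by
    rw [div_mul_cancel_left₀ hq0, qPoch_eq_one_sub_mul hq, div_eq_mul_inv]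
  rw [j, j, hinv, qPoch_eq_one_sub_mul hq x]
  field_simp
  ring

lemma j_base_sq_mul (hq : ‖q‖ < 1) (hq0 : q ≠ 0) {x : ℂ} (hx : x ≠ 0) :
    j (q ^ 2 * x) q = q⁻¹ * (x ^ 2)⁻¹ * j x q := by
  rw [sq, mul_assoc, j_base_mul hq hq0 (mul_ne_zero hq0 hx), j_base_mul hq hq0 hx]
  field_simp

lemma j_ne_zero (hq : ‖q‖ < 1) {x : ℂ} (hx : x ∈ annulus ‖q‖ 1) : j x q ≠ 0 :=
  mul_ne_zero (mul_ne_zero (qPoch_ne_zero hq hx.2) (qPoch_ne_zero hq (norm_div_lt_one hx.1)))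
    (qPoch_ne_zero hq hq)

lemma jDivOneSub_ne_zero (hq : ‖q‖ < 1) {x : ℂ} (hx : x ∈ annulus ‖q‖ ‖q‖⁻¹) :
    jDivOneSub x q ≠ 0 :=
  mul_ne_zero (mul_ne_zero (qPoch_ne_zero hq (norm_mul_lt_one_of_norm_lt_inv hx.2))
    (qPoch_ne_zero hq (norm_div_lt_one hx.1))) (qPoch_ne_zero hq hq)

lemma differentiableAt_j (hq : ‖q‖ < 1) {f : ℂ → ℂ} {x : ℂ} (hf : DifferentiableAt ℂ f x)
    (hx : f x ≠ 0) : DifferentiableAt ℂ (fun x ↦ j (f x) q) x := by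
  have hpoch := differentiable_qPoch hq
  have hinv : DifferentiableAt ℂ (fun x ↦ q / f x) x := (differentiableAt_const q).div hf hx
  exact (((hpoch _).comp x hf).mul ((hpoch _).comp x hinv)).mul_const _

lemma differentiableAt_jDivOneSub (hq : ‖q‖ < 1) {x : ℂ} (hx : x ≠ 0) :
    DifferentiableAt ℂ (fun x ↦ jDivOneSub x q) x := by
  have hpoch := differentiable_qPoch hq
  have hinv : DifferentiableAt ℂ (fun x ↦ q / x) x :=
    (differentiableAt_const q).div differentiableAt_id hx
  exact (((hpoch _).comp x (differentiableAt_id.const_mul q)).mul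
    ((hpoch _).comp x hinv)).mul_const _

lemma j_mul_J_two_sq (hq : ‖q‖ < 1) (hq0 : q ≠ 0) (x : ℂ) :
    j x q * J 2 q ^ 2 = j x (q ^ 2) * j (q * x) (q ^ 2) * J 1 q := by
  have hsplit := qPoch_eq_prod_range hq two_ne_zero
  simp only [Finset.prod_range_succ, Finset.range_zero, Finset.prod_empty, pow_zero, one_mul,
    pow_one] at hsplit
  have hmul : q * (q / x) = q ^ 2 / x := by ring
  have hdiv : q ^ 2 / (q * x) = q / x := by rw [sq, mul_div_mul_left _ _ hq0]
  simp only [j, J, pow_one]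
  rw [hdiv, hsplit x, hsplit (q / x), hmul]
  ring

lemma j_neg_one_mul_J_one (hq : ‖q‖ < 1) : j (-1) q * J 1 q = 2 * J 2 q ^ 2 := by
  have hneg_one : qPoch (-1) q = 2 * qPoch (-q) q := by
    rw [qPoch_eq_one_sub_mul hq, mul_neg_one]
    norm_num
  simp only [j, J, pow_one, ← qPoch_neg_mul_qPoch hq q, hneg_one, div_neg, div_one]
  ring

/-! ### The Jacobi triple product -/

lemma summable_pow_sq_mul_pow {t ρ : ℝ} (ht0 : 0 ≤ t) (ht : t < 1) (hρ : 0 ≤ ρ) :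
    Summable fun n : ℕ ↦ t ^ (n ^ 2) * ρ ^ n := by
  have hlim : Tendsto (fun n : ℕ ↦ t ^ n * ρ) atTop (𝓝 0) := by
    simpa using (tendsto_pow_atTop_nhds_zero_of_lt_one ht0 ht).mul_const ρ
  refine Summable.of_norm_bounded_eventually_nat
    (summable_geometric_of_lt_one (r := 1 / 2) (by norm_num) (by norm_num)) ?_
  filter_upwards [hlim.eventually_le_const (show (0 : ℝ) < 1 / 2 by norm_num)] with n hn
  rw [sq, pow_mul, ← mul_pow, Real.norm_of_nonneg (by positivity)]
  gcongr

lemma summable_zpow_sq_mul_zpow {t ρ : ℝ} (ht0 : 0 ≤ t) (ht : t < 1) (hρ : 0 ≤ ρ) :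
    Summable fun r : ℤ ↦ t ^ (r ^ 2) * ρ ^ r := by
  refine Summable.of_nat_of_neg ?_ ?_
  · exact_mod_cast summable_pow_sq_mul_pow ht0 ht hρ
  · refine (summable_pow_sq_mul_pow ht0 ht (inv_nonneg.mpr hρ)).congr fun n ↦ ?_
    rw [neg_sq, zpow_neg, inv_pow]
    norm_cast

/-- The summand `(-1)^r q^{r²} w^r` of the theta series, which is also the numerator in the Appell
sums. -/
def thetaTerm (q w : ℂ) (r : ℤ) : ℂ := (-1) ^ r * q ^ (r ^ 2) * w ^ r

/-- The theta series `∑_{r ∈ ℤ} (-1)^r q^{r²} w^r`, equal to `j(qw; q²)` by the Jacobi triple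
product identity. -/
def theta (q w : ℂ) : ℂ := ∑' r : ℤ, thetaTerm q w r

lemma norm_thetaTerm (q w : ℂ) (r : ℤ) : ‖thetaTerm q w r‖ = ‖q‖ ^ (r ^ 2) * ‖w‖ ^ r := by
  simp [thetaTerm]

lemma summable_norm_thetaTerm (hq : ‖q‖ < 1) (w : ℂ) : Summable fun r ↦ ‖thetaTerm q w r‖ := by
  simp only [norm_thetaTerm]
  exact summable_zpow_sq_mul_zpow (norm_nonneg q) hq (norm_nonneg w)

lemma thetaTerm_add_one (hq0 : q ≠ 0) {w : ℂ} (hw : w ≠ 0) (r : ℤ) :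
    thetaTerm q w (r + 1) = -(q * w) * (q ^ (2 * r) * thetaTerm q w r) := by
  simp only [thetaTerm]
  rw [show (r + 1) ^ 2 = r ^ 2 + 2 * r + 1 by ring, zpow_add_one₀ hq0, zpow_add₀ hq0,
    zpow_add_one₀ hw, zpow_add_one₀ (by norm_num)]
  ring

lemma thetaTerm_sq_mul (q w : ℂ) (r : ℤ) :
    thetaTerm q (q ^ 2 * w) r = q ^ (2 * r) * thetaTerm q w r := by
  rw [thetaTerm, thetaTerm, mul_zpow, zpow_mul, zpow_ofNat]
  ring

lemma theta_sq_mul (hq0 : q ≠ 0) {w : ℂ} (hw : w ≠ 0) :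
    theta q (q ^ 2 * w) = -(q * w)⁻¹ * theta q w := by
  have hshift : theta q w = -(q * w) * theta q (q ^ 2 * w) := by
    rw [theta, theta, ← (Equiv.addRight (1 : ℤ)).tsum_eq, ← tsum_mul_left]
    refine tsum_congr fun r ↦ ?_
    rw [Equiv.coe_addRight, thetaTerm_add_one hq0 hw, thetaTerm_sq_mul]
  rw [hshift]
  field_simp

lemma zpow_le_zpow_add_zpow {a t b : ℝ} (ha : 0 < a) (hat : a ≤ t) (htb : t ≤ b) (r : ℤ) :
    t ^ r ≤ b ^ r + a ^ r := by
  have ht := ha.trans_le hat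
  have hb := ht.trans_le htb
  rcases le_total 0 r with hr | hr
  · exact (zpow_le_zpow_left₀ hr ht.le htb).trans (le_add_of_nonneg_right (zpow_pos ha r).le)
  · refine le_trans ?_ (le_add_of_nonneg_left (zpow_pos hb r).le)
    simpa only [zpow_neg, inv_inv] using
      inv_anti₀ (zpow_pos ha (-r)) (zpow_le_zpow_left₀ (neg_nonneg.mpr hr) ha.le hat)

lemma differentiableAt_tsum_thetaTerm_mul (hq : ‖q‖ < 1) {a : ℤ → ℂ} {C : ℝ}
    (ha : ∀ r, ‖a r‖ ≤ C) {w : ℂ} (hw : w ≠ 0) :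
    DifferentiableAt ℂ (fun w ↦ ∑' r : ℤ, thetaTerm q w r * a r) w := by
  have hw' : 0 < ‖w‖ := norm_pos_iff.mpr hw
  have hsummable : ∀ {ρ : ℝ}, 0 ≤ ρ → Summable fun r : ℤ ↦ ‖q‖ ^ (r ^ 2) * ρ ^ r :=
    summable_zpow_sq_mul_zpow (norm_nonneg q) hq
  set U := annulus (‖w‖ / 2) (‖w‖ + 1)
  have hU : IsOpen U := isOpen_annulus _ _
  have hdiff : DifferentiableOn ℂ (fun w ↦ ∑' r : ℤ, thetaTerm q w r * a r) U := by
    refine Complex.differentiableOn_tsum_of_summable_norm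
      (u := fun r ↦ (‖q‖ ^ (r ^ 2) * (‖w‖ + 1) ^ r + ‖q‖ ^ (r ^ 2) * (‖w‖ / 2) ^ r) * C)
      (((hsummable (by positivity)).add (hsummable (by positivity))).mul_right C)
      (fun r z hz ↦ ?_) hU fun r z hz ↦ ?_
    · have hz0 : z ≠ 0 := ne_zero_of_mem_annulus (by positivity) hz
      exact (((differentiableAt_zpow.mpr (Or.inl hz0)).const_mul _).mul_const
        _).differentiableWithinAt
    · rw [norm_mul, norm_thetaTerm, ← mul_add]
      gcongr
      · exact zpow_le_zpow_add_zpow (by positivity) hz.1.le hz.2.le r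
      · exact ha r
  exact hdiff.differentiableAt (hU.mem_nhds ⟨by linarith, by linarith⟩)

lemma differentiableAt_theta (hq : ‖q‖ < 1) {w : ℂ} (hw : w ≠ 0) :
    DifferentiableAt ℂ (fun w ↦ theta q w) w := by
  simpa [theta] using differentiableAt_tsum_thetaTerm_mul hq (a := fun _ ↦ 1) (C := 1) (by simp) hw

lemma norm_pow_mul_prod_one_sub_pow_le {c : ℂ} (hc : ‖c‖ < 1) (k n : ℕ) :
    ‖c ^ ((k + 1) * n) * ∏ i ∈ Finset.range (n + 1), (1 - c ^ (k + i + 1))‖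
      ≤ Real.exp (1 - ‖c‖)⁻¹ * ‖c‖ ^ n := by
  have hsum : ∑ i ∈ Finset.range (n + 1), ‖-c ^ (k + i + 1)‖ ≤ (1 - ‖c‖)⁻¹ := by
    rw [← tsum_geometric_of_lt_one (norm_nonneg c) hc]
    refine le_trans (Finset.sum_le_sum fun i _ ↦ ?_)
      ((summable_geometric_of_lt_one (norm_nonneg c) hc).sum_le_tsum (Finset.range (n + 1))
        fun i _ ↦ by positivity)
    rw [norm_neg, norm_pow]
    exact pow_le_pow_of_le_one (norm_nonneg _) hc.le (by lia)
  have hprod : ‖∏ i ∈ Finset.range (n + 1), (1 - c ^ (k + i + 1))‖ ≤ Real.exp (1 - ‖c‖)⁻¹ := by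
    have hdist := Finset.norm_prod_one_add_sub_one_le (Finset.range (n + 1))
      (fun i ↦ -c ^ (k + i + 1))
    have htri := norm_le_norm_add_norm_sub'
      (∏ i ∈ Finset.range (n + 1), (1 + -c ^ (k + i + 1))) 1
    simp only [← sub_eq_add_neg, norm_one] at hdist htri
    linarith [Real.exp_le_exp.mpr hsum]
  rw [norm_mul, norm_pow, mul_comm]
  gcongr ?_ * ?_
  exact pow_le_pow_of_le_one (norm_nonneg _) hc.le (Nat.le_mul_of_pos_left n k.succ_pos)

lemma tendsto_pentagonal_tail {c : ℂ} (hc : ‖c‖ < 1) :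
    Tendsto (fun k : ℕ ↦ (-1) ^ (k + 1) * c ^ ((k + 1) * (3 * k + 4) / 2) *
      ∑' n, c ^ ((k + 1) * n) * ∏ i ∈ Finset.range (n + 1), (1 - c ^ (k + i + 1)))
      atTop (𝓝 0) := by
  set M := Real.exp (1 - ‖c‖)⁻¹
  have hgeom := (summable_geometric_of_lt_one (norm_nonneg c) hc).mul_left M
  have hlim : Tendsto (fun k : ℕ ↦ ‖c‖ ^ k * ∑' n : ℕ, M * ‖c‖ ^ n) atTop (𝓝 0) := by
    simpa using (tendsto_pow_atTop_nhds_zero_of_lt_one (norm_nonneg c) hc).mul_const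
      (∑' n : ℕ, M * ‖c‖ ^ n)
  refine squeeze_zero_norm (fun k ↦ ?_) hlim
  rw [norm_mul, norm_mul, norm_pow, norm_neg, norm_one, one_pow, one_mul, norm_pow]
  gcongr ?_ * ?_
  · refine pow_le_pow_of_le_one (norm_nonneg _) hc.le ?_
    rw [Nat.le_div_iff_mul_le two_pos]
    nlinarith
  · exact tsum_of_norm_bounded hgeom.hasSum (norm_pow_mul_prod_one_sub_pow_le hc k)

lemma qPoch_self_eq_tsum_pentagonal {c : ℂ} (hc : ‖c‖ < 1)
    (hs : Summable fun r : ℤ ↦ (-1) ^ r * c ^ pentagonal r) :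
    qPoch c c = ∑' r : ℤ, (-1) ^ r * c ^ pentagonal r := by
  have hpair : HasSum
      (fun k : ℕ ↦ (-1) ^ k * (c ^ pentagonal (-k) - c ^ pentagonal (k + 1)))
      (∑' r : ℤ, (-1) ^ r * c ^ pentagonal r) := by
    convert ((Equiv.neg ℤ).hasSum_iff.mpr hs.hasSum).nat_add_neg_add_one using 2 with k
    simp only [Function.comp_apply, Equiv.neg_apply, neg_neg, zpow_neg, zpow_natCast,
      zpow_add_one₀ (show (-1 : ℂ) ≠ 0 by norm_num), ← inv_pow, inv_neg, inv_one]
    ring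
  rw [← hpair.tsum_eq, ← Pentagonal.tprod_one_sub_pow
    (tendsto_pow_atTop_nhds_zero_of_norm_lt_one hc)
    (fun k ↦ Summable.of_norm_bounded
      ((summable_geometric_of_lt_one (norm_nonneg c) hc).mul_left _)
      (norm_pow_mul_prod_one_sub_pow_le hc k))
    (fun k ↦ (multipliable_qPoch hc (c ^ (k + 1))).congr fun n ↦ by rw [← pow_add, add_assoc])
    hpair.summable (tendsto_pentagonal_tail hc)]
  simp only [qPoch, pow_succ]

lemma thetaTerm_div_eq_pentagonal (hq0 : q ≠ 0) {c : ℂ} (hc0 : c ≠ 0) (hcq : c ^ 3 = q ^ 2)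
    (r : ℤ) : thetaTerm q (c / q) r = (-1) ^ r * c ^ pentagonal r := by
  obtain ⟨k, hk⟩ := Int.even_mul_pred_self r
  have hsq : r ^ 2 = 2 * k + r := by linarith
  have hpent : (pentagonal r : ℤ) = 3 * k + r := by linarith [two_mul_natCast_pentagonal r]
  have hcq' : c ^ (3 : ℤ) = q ^ (2 : ℤ) := mod_cast hcq
  have := zpow_ne_zero r hq0
  rw [thetaTerm, hsq, ← zpow_natCast c, hpent, zpow_add₀ hq0, zpow_add₀ hc0, div_zpow, zpow_mul,
    zpow_mul, hcq']
  field_simp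

/-- Normalizes the Jacobi triple product: at `w = c / q` the theta series is Euler's pentagonal
series in `c`. -/
lemma theta_eq_j_of_pow_three_eq (hq : ‖q‖ < 1) (hq0 : q ≠ 0) {c : ℂ} (hc : ‖c‖ < 1)
    (hc0 : c ≠ 0) (hcq : c ^ 3 = q ^ 2) :
    theta q (c / q) = qPoch c c ∧ j (q * (c / q)) (q ^ 2) = qPoch c c := by
  have hterm := thetaTerm_div_eq_pentagonal hq0 hc0 hcq
  constructor
  · rw [qPoch_self_eq_tsum_pentagonal hc, theta, tsum_congr hterm]
    exact (summable_norm_thetaTerm hq (c / q)).of_norm.congr hterm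
  · rw [mul_div_cancel₀ _ hq0, ← hcq, j, qPoch_eq_prod_range hc three_ne_zero c]
    rw [Finset.prod_range_succ, Finset.prod_range_succ, Finset.prod_range_one, pow_zero, one_mul,
      pow_one, show c ^ 3 / c = c * c by field_simp, ← sq, ← pow_succ]

lemma theta_eq_j (hq : ‖q‖ < 1) (hq0 : q ≠ 0) {w : ℂ} (hw : w ≠ 0) :
    theta q w = j (q * w) (q ^ 2) := by
  have hq2 := norm_pow_lt_one hq two_ne_zero
  have hq20 : q ^ 2 ≠ 0 := pow_ne_zero 2 hq0
  obtain ⟨c, hcq⟩ := IsAlgClosed.exists_pow_nat_eq (q ^ 2) three_pos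
  have hc0 : c ≠ 0 := by
    rintro rfl
    exact hq20 (by rw [← hcq, zero_pow three_ne_zero])
  have hc : ‖c‖ < 1 := by
    rwa [← pow_lt_one_iff_of_nonneg (norm_nonneg c) three_ne_zero, ← norm_pow, hcq]
  obtain ⟨htheta, hj⟩ := theta_eq_j_of_pow_three_eq hq hq0 hc hc0 hcq
  set b := max (max ‖w‖ ‖c / q‖) 1 + 1
  have hmem : ∀ {z : ℂ}, z ≠ 0 → ‖z‖ ≤ max (max ‖w‖ ‖c / q‖) 1 → z ∈ annulus 0 b :=
    fun hz hzb ↦ ⟨norm_pos_iff.mpr hz, hzb.trans_lt (lt_add_one _)⟩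
  have hne : ∀ {z : ℂ}, z ∈ annulus 0 b → z ≠ 0 := ne_zero_of_mem_annulus le_rfl
  have hne' : ∀ {z : ℂ}, ‖z‖ = 1 → z ≠ 0 := fun hz ↦ norm_pos_iff.mp (hz ▸ one_pos)
  have hcross := mul_eq_mul_of_quasiPeriodic le_rfl hq2.le
    (neg_ne_zero.mpr (inv_ne_zero hq0)) (f := fun w ↦ theta q w) (g := fun w ↦ j (q * w) (q ^ 2))
    (fun z hz ↦ (differentiableAt_theta hq (hne hz)).differentiableWithinAt)
    (fun z hz ↦ (differentiableAt_j hq2 (differentiableAt_id.const_mul q)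
      (mul_ne_zero hq0 (hne hz))).differentiableWithinAt)
    (by rwa [mul_one, norm_pos_iff])
    (show 1 < b from (le_max_right _ _).trans_lt (lt_add_one _))
    (fun z hz ↦ by rw [theta_sq_mul hq0 (hne' hz), mul_inv]; ring)
    (fun z hz ↦ by
      rw [mul_left_comm, j_base_mul hq2 hq20 (mul_ne_zero hq0 (hne' hz)), mul_inv]
      ring)
    (hmem hw (by simp)) (hmem (div_ne_zero hc0 hq0) (by simp))
  rw [htheta, hj, mul_comm] at hcross
  exact mul_left_cancel₀ (qPoch_ne_zero hc hc) hcross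

/-! ### Lambert series and Appell sums -/

/-- The series `∑_i a_i / (1 - z q^{n_i})`, the common form of the Appell sums, of Kronecker's
series and of the triple sum after summation over one of its indices. -/
def lambertSeries {ι : Type*} (q : ℂ) (a : ι → ℂ) (n : ι → ℕ) (z : ℂ) : ℂ :=
  ∑' i, a i / (1 - z * q ^ n i)

section LambertSeries

variable {ι : Type*} {a : ι → ℂ}

lemma exists_norm_one_sub_inv_le (hq : ‖q‖ < 1) (z : ℂ) :
    ∃ C : ℝ, ∀ n : ℕ, ‖(1 - z * q ^ n)⁻¹‖ ≤ C := by
  have hlim : Tendsto (fun n : ℕ ↦ (1 - z * q ^ n)⁻¹) atTop (𝓝 1) := by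
    have hpow := (tendsto_pow_atTop_nhds_zero_of_norm_lt_one hq).const_mul z
    simpa using (hpow.const_sub 1).inv₀ (by simp)
  obtain ⟨C, hC⟩ := (Metric.isBounded_range_of_tendsto _ hlim).exists_norm_le
  exact ⟨C, fun n ↦ hC _ ⟨n, rfl⟩⟩

lemma summable_lambertSeries (hq : ‖q‖ < 1) (ha : Summable fun i ↦ ‖a i‖) (n : ι → ℕ) (z : ℂ) :
    Summable fun i ↦ a i / (1 - z * q ^ n i) := by
  obtain ⟨C, hC⟩ := exists_norm_one_sub_inv_le hq z
  refine Summable.of_norm_bounded (ha.mul_right C) fun i ↦ ?_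
  rw [div_eq_mul_inv, norm_mul]
  gcongr
  exact hC _

lemma norm_mul_pow_le (hq : ‖q‖ ≤ 1) (z : ℂ) (n : ℕ) : ‖z * q ^ n‖ ≤ ‖z‖ := by
  rw [norm_mul, norm_pow]
  exact mul_le_of_le_one_right (norm_nonneg z) (pow_le_one₀ (norm_nonneg q) hq)

lemma lambertSeries_eq_tsum (hq : ‖q‖ ≤ 1) (ha : Summable fun i ↦ ‖a i‖) (n : ι → ℕ) {z : ℂ}
    (hz : ‖z‖ < 1) :
    lambertSeries q a n z = ∑' p : ι × ℕ, a p.1 * (z * q ^ n p.1) ^ p.2 := by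
  have hsum : Summable fun p : ι × ℕ ↦ a p.1 * (z * q ^ n p.1) ^ p.2 := by
    refine Summable.of_norm_bounded (ha.mul_of_nonneg (summable_geometric_of_lt_one
      (norm_nonneg z) hz) (fun _ ↦ norm_nonneg _) fun _ ↦ by positivity) fun p ↦ ?_
    rw [norm_mul, norm_pow]
    gcongr
    exact norm_mul_pow_le hq z _
  rw [lambertSeries, hsum.tsum_prod]
  refine tsum_congr fun i ↦ ?_
  dsimp only
  rw [tsum_mul_left, tsum_geometric_of_norm_lt_one ((norm_mul_pow_le hq z _).trans_lt hz),
    div_eq_mul_inv]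

lemma differentiableAt_lambertSeries (hq : ‖q‖ ≤ 1) (ha : Summable fun i ↦ ‖a i‖) (n : ι → ℕ)
    {z : ℂ} (hz : ‖z‖ < 1) : DifferentiableAt ℂ (fun z ↦ lambertSeries q a n z) z := by
  obtain ⟨b, hzb, hb⟩ := exists_between hz
  have hlow : ∀ w ∈ Metric.ball (0 : ℂ) b, ∀ k : ℕ, 1 - b ≤ ‖1 - w * q ^ k‖ := fun w hw k ↦ by
    have htri := norm_sub_norm_le (1 : ℂ) (w * q ^ k)
    rw [norm_one] at htri
    linarith [norm_mul_pow_le hq w k, mem_ball_zero_iff.mp hw]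
  have hdiff : DifferentiableOn ℂ (fun z ↦ lambertSeries q a n z) (Metric.ball 0 b) := by
    refine Complex.differentiableOn_tsum_of_summable_norm (ha.mul_right (1 - b)⁻¹)
      (fun i w hw ↦ ?_) Metric.isOpen_ball fun i w hw ↦ ?_
    · have hne : 1 - w * q ^ n i ≠ 0 :=
        norm_pos_iff.mp ((sub_pos.mpr hb).trans_le (hlow w hw (n i)))
      exact DifferentiableAt.differentiableWithinAt (by fun_prop (disch := exact hne))
    · rw [norm_div, div_eq_mul_inv]
      exact mul_le_mul_of_nonneg_left (inv_anti₀ (sub_pos.mpr hb) (hlow w hw (n i)))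
        (norm_nonneg _)
  exact hdiff.differentiableAt (Metric.isOpen_ball.mem_nhds (mem_ball_zero_iff.mpr hzb))

end LambertSeries

/-- The Appell sum `∑_{r ∈ ℤ} (-1)^r q^{r²} w^r / (1 + q^{2r} x)`; up to the factor `j(qw; q²)` this
is `m(-qx/w, q², qw)`. -/
def appell (q x w : ℂ) : ℂ := ∑' r : ℤ, thetaTerm q w r / (1 + q ^ (2 * r) * x)

lemma exists_norm_one_add_zpow_mul_inv_le (hq : ‖q‖ < 1) {x : ℂ} (hx : x ≠ 0) (hq0 : q ≠ 0) :
    ∃ C : ℝ, ∀ r : ℤ, ‖(1 + q ^ (2 * r) * x)⁻¹‖ ≤ C := by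
  have hq2 := norm_pow_lt_one hq two_ne_zero
  obtain ⟨C, hC⟩ := exists_norm_one_sub_inv_le hq2 (-x)
  obtain ⟨C', hC'⟩ := exists_norm_one_sub_inv_le hq2 (-x⁻¹)
  have hflip : ∀ t : ℂ, t ≠ 0 → (1 + t⁻¹ * x)⁻¹ = x⁻¹ * t * (1 - -x⁻¹ * t)⁻¹ := fun t ht ↦ by
    rw [show 1 + t⁻¹ * x = (x⁻¹ * t)⁻¹ * (1 - -x⁻¹ * t) by field_simp; ring, mul_inv, inv_inv]
  refine ⟨max C (‖x⁻¹‖ * C'), fun r ↦ ?_⟩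
  obtain ⟨n, rfl | rfl⟩ := r.eq_nat_or_neg
  · refine le_max_of_le_left ?_
    rw [zpow_mul, zpow_ofNat, zpow_natCast]
    simpa only [neg_mul, sub_neg_eq_add, mul_comm] using hC n
  · refine le_max_of_le_right ?_
    rw [zpow_mul, zpow_ofNat, zpow_neg, zpow_natCast, hflip _ (pow_ne_zero n (pow_ne_zero 2 hq0)),
      norm_mul]
    gcongr
    · exact norm_mul_pow_le hq2.le _ n
    · exact hC' n

lemma summable_appell (hq : ‖q‖ < 1) (hq0 : q ≠ 0) {x : ℂ} (hx : x ≠ 0) (w : ℂ) :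
    Summable fun r : ℤ ↦ thetaTerm q w r / (1 + q ^ (2 * r) * x) := by
  obtain ⟨C, hC⟩ := exists_norm_one_add_zpow_mul_inv_le hq hx hq0
  refine Summable.of_norm_bounded ((summable_norm_thetaTerm hq w).mul_right C) fun r ↦ ?_
  rw [div_eq_mul_inv, norm_mul]
  gcongr
  exact hC r

lemma differentiableAt_appell_right (hq : ‖q‖ < 1) (hq0 : q ≠ 0) {x w : ℂ} (hx : x ≠ 0)
    (hw : w ≠ 0) : DifferentiableAt ℂ (fun w ↦ appell q x w) w := by
  obtain ⟨C, hC⟩ := exists_norm_one_add_zpow_mul_inv_le hq hx hq0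
  simpa only [appell, div_eq_mul_inv] using differentiableAt_tsum_thetaTerm_mul hq hC hw

lemma one_add_zpow_mul_ne_zero (hq : ‖q‖ < 1) {x : ℂ} (hx : x ∈ annulus ‖q ^ 2‖ ‖q ^ 2‖⁻¹)
    (hq0 : q ≠ 0) (hx1 : x ≠ -1) (r : ℤ) : 1 + q ^ (2 * r) * x ≠ 0 := by
  intro h
  have hpos : 0 < ‖q ^ 2‖ := norm_pos_iff.mpr (pow_ne_zero 2 hq0)
  have hq2 := norm_pow_lt_one hq two_ne_zero
  have hx' : x = -(q ^ 2) ^ (-r) := by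
    rw [zpow_neg, ← zpow_natCast q 2, ← zpow_mul, Nat.cast_two]
    have := zpow_ne_zero (2 * r) hq0
    field_simp
    linear_combination h
  obtain ⟨hlow, hup⟩ := hx
  rw [hx', norm_neg, norm_zpow] at hlow hup
  rw [← zpow_neg_one, zpow_lt_zpow_iff_right_of_lt_one₀ hpos hq2] at hup
  nth_rewrite 1 [← zpow_one ‖q ^ 2‖] at hlow
  rw [zpow_lt_zpow_iff_right_of_lt_one₀ hpos hq2] at hlow
  obtain rfl : r = 0 := by lia
  exact hx1 (by simpa using hx')

lemma appell_eq_add_lambertSeries (hq : ‖q‖ < 1) (hq0 : q ≠ 0) {x : ℂ} (hx : x ≠ 0) (w : ℂ) :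
    appell q x w = 1 / (1 + x)
      + lambertSeries (q ^ 2) (fun k : ℕ ↦ thetaTerm q w (k + 1)) id (-(q ^ 2 * x))
      + x⁻¹ * lambertSeries (q ^ 2) (fun k : ℕ ↦ thetaTerm q w (-(k + 1)) * (q ^ 2) ^ (k + 1)) id
          (-(q ^ 2 / x)) := by
  set F : ℤ → ℂ := fun r ↦ thetaTerm q w r / (1 + q ^ (2 * r) * x) with hF
  have hs : Summable F := summable_appell hq hq0 hx w
  have hnat : Summable fun k : ℕ ↦ F k := hs.comp_injective Nat.cast_injective
  have hneg : Summable fun k : ℕ ↦ F (-((k : ℤ) + 1)) :=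
    hs.comp_injective fun a b h ↦ by simpa using h
  have hzpow : ∀ k : ℕ, q ^ (2 * ((k : ℤ) + 1)) = (q ^ 2) ^ (k + 1) := fun k ↦ by
    rw [zpow_mul, zpow_ofNat, ← Nat.cast_succ, zpow_natCast]
  have hF0 : F ((0 : ℕ) : ℤ) = 1 / (1 + x) := by simp [hF, thetaTerm]
  have hFpos : ∀ k : ℕ, F ((k + 1 : ℕ) : ℤ)
      = thetaTerm q w (k + 1) / (1 - -(q ^ 2 * x) * (q ^ 2) ^ k) := fun k ↦ by
    simp only [hF, Nat.cast_succ, hzpow]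
    congr 1
    ring
  have hFneg : ∀ k : ℕ, F (-((k : ℤ) + 1)) = x⁻¹ *
      (thetaTerm q w (-(k + 1)) * (q ^ 2) ^ (k + 1) / (1 - -(q ^ 2 / x) * (q ^ 2) ^ k)) :=
    fun k ↦ by
      simp only [hF, mul_neg, zpow_neg, hzpow]
      have hk : (q ^ 2) ^ (k + 1) ≠ 0 := pow_ne_zero _ (pow_ne_zero 2 hq0)
      rw [show 1 + ((q ^ 2) ^ (k + 1))⁻¹ * x
        = x * ((q ^ 2) ^ (k + 1))⁻¹ * (1 - -(q ^ 2 / x) * (q ^ 2) ^ k) by field_simp; ring]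
      field_simp
  calc appell q x w = ∑' k : ℕ, F k + ∑' k : ℕ, F (-((k : ℤ) + 1)) :=
        tsum_of_nat_of_neg_add_one hnat hneg
    _ = _ := by
        rw [hnat.tsum_eq_zero_add, hF0, tsum_congr hFpos, tsum_congr hFneg, tsum_mul_left]
        rfl

lemma exists_differentiableOn_appell_eq (hq : ‖q‖ < 1) (hq0 : q ≠ 0) (w : ℂ) :
    ∃ f : ℂ → ℂ, DifferentiableOn ℂ f (annulus ‖q ^ 2‖ ‖q ^ 2‖⁻¹) ∧
      ∀ x ∈ annulus ‖q ^ 2‖ ‖q ^ 2‖⁻¹, appell q x w = 1 / (1 + x) + f x := by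
  have hq2 := norm_pow_lt_one hq two_ne_zero
  have htheta := summable_norm_thetaTerm hq w
  have hpos : Summable fun k : ℕ ↦ ‖thetaTerm q w (k + 1)‖ :=
    htheta.comp_injective (i := fun k : ℕ ↦ (k : ℤ) + 1) fun a b h ↦ by simpa using h
  have hneg : Summable fun k : ℕ ↦ ‖thetaTerm q w (-(k + 1)) * (q ^ 2) ^ (k + 1)‖ :=
    (htheta.comp_injective (i := fun k : ℕ ↦ -((k : ℤ) + 1)) fun a b h ↦ by
      simpa using h).of_nonneg_of_le (fun _ ↦ norm_nonneg _) fun k ↦ norm_mul_pow_le hq2.le _ _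
  refine ⟨fun x ↦ _ + _, fun x hx ↦ ?_, fun x hx ↦ (appell_eq_add_lambertSeries hq hq0
    (ne_zero_of_mem_annulus (norm_nonneg _) hx) w).trans (add_assoc _ _ _)⟩
  have hx0 := ne_zero_of_mem_annulus (norm_nonneg _) hx
  have hmul : ‖-(q ^ 2 * x)‖ < 1 := by
    rw [norm_neg]
    exact norm_mul_lt_one_of_norm_lt_inv hx.2
  have hdiv : ‖-(q ^ 2 / x)‖ < 1 := by
    rw [norm_neg]
    exact norm_div_lt_one hx.1
  have hf := (differentiableAt_lambertSeries hq2.le hpos id hmul).fun_comp' x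
    (f := fun x ↦ -(q ^ 2 * x)) (by fun_prop)
  have hg := (differentiableAt_lambertSeries hq2.le hneg id hdiv).fun_comp' x
    (f := fun x ↦ -(q ^ 2 / x)) (by fun_prop (disch := exact hx0))
  exact (hf.add ((differentiableAt_inv hx0).mul hg)).differentiableWithinAt

lemma appell_sq_mul_right (hq : ‖q‖ < 1) (hq0 : q ≠ 0) {x : ℂ} (hx0 : x ≠ 0)
    (hx : ∀ r : ℤ, 1 + q ^ (2 * r) * x ≠ 0) (w : ℂ) :
    x * appell q x (q ^ 2 * w) = theta q w - appell q x w := by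
  rw [theta, appell, appell, ← (summable_norm_thetaTerm hq w).of_norm.tsum_sub
    (summable_appell hq hq0 hx0 w), ← tsum_mul_left]
  refine tsum_congr fun r ↦ ?_
  have h := hx r
  rw [thetaTerm_sq_mul, eq_sub_iff_add_eq, ← mul_div_assoc, ← add_div, div_eq_iff h]
  ring

lemma appell_sq_mul_left (hq : ‖q‖ < 1) (hq0 : q ≠ 0) {x : ℂ} (hx0 : x ≠ 0)
    (hx : ∀ r : ℤ, 1 + q ^ (2 * r) * x ≠ 0) {w : ℂ} (hw : w ≠ 0) :
    appell q (q ^ 2 * x) w = q * x / w * appell q x w + theta q w := by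
  set f : ℤ → ℂ := fun r ↦ thetaTerm q w r / (1 + q ^ (2 * r) * x) with hf
  have hs : Summable f := summable_appell hq hq0 hx0 w
  have hs' : Summable fun r : ℤ ↦ q * x / w * f (r + 1) :=
    (hs.comp_injective (add_left_injective (1 : ℤ))).mul_left _
  have hshift : ∑' r : ℤ, f (r + 1) = appell q x w := (Equiv.addRight (1 : ℤ)).tsum_eq f
  rw [← hshift, theta, appell, ← tsum_mul_left,
    ← hs'.tsum_add (summable_norm_thetaTerm hq w).of_norm]
  refine tsum_congr fun r ↦ ?_
  have h := hx (r + 1)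
  have hpow : q ^ (2 * (r + 1)) = q ^ 2 * q ^ (2 * r) := by
    rw [mul_add, zpow_add₀ hq0, mul_comm, mul_one, zpow_ofNat]
  simp only [hf]
  rw [thetaTerm_add_one hq0 hw]
  rw [hpow] at h ⊢
  generalize q ^ (2 * r) = t at h ⊢
  rw [show 1 + t * (q ^ 2 * x) = 1 + q ^ 2 * t * x by ring]
  field_simp
  ring

/-! ### Kronecker's identity and the continuation of the triple sum -/

/-- The Lambert series `∑_{r ≥ 0} x^r / (1 - z q^r)`. -/
def lambert (q x z : ℂ) : ℂ := lambertSeries q (fun r : ℕ ↦ x ^ r) id z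

/-- Kronecker's series `∑_{r ∈ ℤ} x^r / (1 - z q^r)`, with its two halves summed separately. -/
def kronecker (q x z : ℂ) : ℂ := lambert q x z - q / (x * z) * lambert q (q / x) (q / z)

/-- The double series `∑_{r, s ≥ 0} q^{rs} x^r y^s / (1 - z q^{r+s})`. -/
def doubleSum (q x y z : ℂ) : ℂ :=
  lambertSeries q (fun p : ℕ × ℕ ↦ q ^ (p.1 * p.2) * x ^ p.1 * y ^ p.2) (fun p ↦ p.1 + p.2) z

/-- The meromorphic continuation in `z` of the triple sum, obtained by summing over the exponent
of `z` in each octant. -/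
def heckeSum (q x y z : ℂ) : ℂ :=
  doubleSum q x y z + q ^ 3 / (x * y * z) * doubleSum q (q ^ 2 / x) (q ^ 2 / y) (q ^ 2 / z)

lemma summable_norm_pow {x : ℂ} (hx : ‖x‖ < 1) : Summable fun r : ℕ ↦ ‖x ^ r‖ := by
  simpa only [norm_pow] using summable_geometric_of_lt_one (norm_nonneg x) hx

lemma summable_norm_pow_mul_pow_mul_pow (hq : ‖q‖ ≤ 1) {x y : ℂ} (hx : ‖x‖ < 1) (hy : ‖y‖ < 1) :
    Summable fun p : ℕ × ℕ ↦ ‖q ^ (p.1 * p.2) * x ^ p.1 * y ^ p.2‖ := by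
  refine ((summable_norm_pow hx).mul_of_nonneg (summable_norm_pow hy) (fun _ ↦ norm_nonneg _)
    fun _ ↦ norm_nonneg _).of_nonneg_of_le (fun _ ↦ norm_nonneg _) fun p ↦ ?_
  rw [mul_assoc, norm_mul, norm_pow, norm_mul]
  exact mul_le_of_le_one_left (by positivity) (pow_le_one₀ (norm_nonneg q) hq)

lemma norm_mul_lt_one (hq : ‖q‖ ≤ 1) {x : ℂ} (hx : ‖x‖ < 1) : ‖q * x‖ < 1 := by
  rw [norm_mul]
  exact mul_lt_one_of_nonneg_of_lt_one_right hq (norm_nonneg x) hx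

lemma differentiableAt_lambert (hq : ‖q‖ ≤ 1) {x z : ℂ} (hx : ‖x‖ < 1) (hz : ‖z‖ < 1) :
    DifferentiableAt ℂ (fun z ↦ lambert q x z) z :=
  differentiableAt_lambertSeries hq (summable_norm_pow hx) id hz

lemma differentiableAt_doubleSum (hq : ‖q‖ ≤ 1) {x y z : ℂ} (hx : ‖x‖ < 1) (hy : ‖y‖ < 1)
    (hz : ‖z‖ < 1) : DifferentiableAt ℂ (fun z ↦ doubleSum q x y z) z :=
  differentiableAt_lambertSeries hq (summable_norm_pow_mul_pow_mul_pow hq hx hy) _ hz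

lemma lambert_eq_add (hq : ‖q‖ < 1) {x : ℂ} (hx : ‖x‖ < 1) (z : ℂ) :
    lambert q x z = 1 / (1 - z) + x * lambert q x (q * z) := by
  have hs := summable_lambertSeries hq (summable_norm_pow hx) id z
  rw [lambert, lambertSeries, hs.tsum_eq_zero_add, lambert, lambertSeries, ← tsum_mul_left]
  congr 1
  · simp
  · refine tsum_congr fun r ↦ ?_
    rw [id, id, pow_succ' q, pow_succ', ← mul_assoc, mul_comm z q, mul_div_assoc]

lemma doubleSum_comm (q x y z : ℂ) : doubleSum q x y z = doubleSum q y x z := by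
  rw [doubleSum, lambertSeries, doubleSum, lambertSeries, ← (Equiv.prodComm ℕ ℕ).tsum_eq]
  refine tsum_congr fun p ↦ ?_
  simp only [Equiv.prodComm_apply, Prod.fst_swap, Prod.snd_swap, mul_comm p.2, add_comm p.2]
  ring

lemma doubleSum_eq_lambert_add_left_mul (hq : ‖q‖ < 1) {x y : ℂ} (hx : ‖x‖ < 1) (hy : ‖y‖ < 1)
    (z : ℂ) : doubleSum q x y z = lambert q y z + x * doubleSum q x (q * y) (q * z) := by
  have hs := summable_lambertSeries hq (summable_norm_pow_mul_pow_mul_pow hq.le hx hy)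
    (fun p ↦ p.1 + p.2) z
  have hs' := summable_lambertSeries hq (summable_norm_pow_mul_pow_mul_pow hq.le hx
    (norm_mul_lt_one hq.le hy)) (fun p ↦ p.1 + p.2) (q * z)
  rw [doubleSum, lambertSeries, hs.tsum_prod, hs.prod.tsum_eq_zero_add, lambert, lambertSeries,
    doubleSum, lambertSeries, hs'.tsum_prod, ← tsum_mul_left]
  congr 1
  · simp
  · refine tsum_congr fun r ↦ ?_
    rw [← tsum_mul_left]
    refine tsum_congr fun s ↦ ?_
    rw [show z * q ^ (r + 1 + s) = q * z * q ^ (r + s) by ring]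
    ring

lemma doubleSum_eq_lambert_add_right_mul (hq : ‖q‖ < 1) {x y : ℂ} (hx : ‖x‖ < 1) (hy : ‖y‖ < 1)
    {z : ℂ} (hz : ∀ n : ℕ, 1 - z * q ^ n ≠ 0) :
    doubleSum q x y z = lambert q x y + z * doubleSum q (q * x) (q * y) z := by
  have hs := summable_norm_pow_mul_pow_mul_pow hq.le hx hy
  have hs' := summable_lambertSeries hq (summable_norm_pow_mul_pow_mul_pow hq.le
    (norm_mul_lt_one hq.le hx) (norm_mul_lt_one hq.le hy)) (fun p ↦ p.1 + p.2) z
  have hlambert : lambert q x y = ∑' p : ℕ × ℕ, q ^ (p.1 * p.2) * x ^ p.1 * y ^ p.2 := by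
    rw [lambert, lambertSeries_eq_tsum hq.le (summable_norm_pow hx) id hy]
    refine tsum_congr fun p ↦ ?_
    rw [mul_pow, ← pow_mul, id]
    ring
  rw [hlambert, doubleSum, lambertSeries, doubleSum, lambertSeries, ← tsum_mul_left,
    ← hs.of_norm.tsum_add (hs'.mul_left z)]
  refine tsum_congr fun p ↦ ?_
  have hne := hz (p.1 + p.2)
  field_simp
  ring

lemma kronecker_base_mul (hq : ‖q‖ < 1) {x z : ℂ} (hx : x ∈ annulus ‖q‖ 1) (hq0 : q ≠ 0)
    (hz : z ≠ 0) (hz1 : z ≠ 1) : x * kronecker q x (q * z) = kronecker q x z := by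
  have hx0 := ne_zero_of_mem_annulus (norm_nonneg q) hx
  have hleft := lambert_eq_add hq hx.2 z
  have hright := lambert_eq_add hq (norm_div_lt_one hx.1) (1 / z)
  rw [show q * (1 / z) = q / z by ring] at hright
  have hz' : 1 - z ≠ 0 := sub_ne_zero.mpr hz1.symm
  have hinv : 1 / (1 - 1 / z) = -z * (1 / (1 - z)) := by
    rw [one_sub_div hz, one_div_div, ← neg_sub 1 z, div_neg]
    ring
  rw [kronecker, kronecker, show q / (q * z) = 1 / z by field_simp, hleft, hright, hinv]
  field_simp
  ring

lemma heckeSum_comm (q x y z : ℂ) : heckeSum q x y z = heckeSum q y x z := by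
  rw [heckeSum, heckeSum, doubleSum_comm q x y, doubleSum_comm q (q ^ 2 / x), mul_comm x y]

lemma heckeSum_eq_kronecker_add_left_mul (hq : ‖q‖ < 1) (hq0 : q ≠ 0) {x y z : ℂ}
    (hx : x ∈ annulus ‖q ^ 2‖ 1) (hy : y ∈ annulus ‖q‖ 1) (hz : z ≠ 0) :
    heckeSum q x y z = kronecker q y z + x * heckeSum q x (q * y) (q * z) := by
  have hx0 := ne_zero_of_mem_annulus (norm_nonneg _) hx
  have hy0 := ne_zero_of_mem_annulus (norm_nonneg _) hy
  have hleft := doubleSum_eq_lambert_add_left_mul hq hx.2 hy.2 z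
  have hright := doubleSum_eq_lambert_add_left_mul hq (norm_div_lt_one hx.1) (norm_div_lt_one hy.1)
    (q / z)
  have hdiv : ∀ w, q ^ 2 / (q * w) = q / w := fun w ↦ by rw [pow_two, mul_div_mul_left _ _ hq0]
  have hmul : ∀ w, q * (q / w) = q ^ 2 / w := fun w ↦ by ring
  rw [hmul, hmul] at hright
  rw [heckeSum, heckeSum, kronecker, hdiv, hdiv, hleft, hright]
  field_simp
  ring

lemma heckeSum_eq_kronecker_add_right_mul (hq : ‖q‖ < 1) (hq0 : q ≠ 0) {x y z : ℂ}
    (hx : x ∈ annulus ‖q‖ 1) (hy : y ∈ annulus ‖q‖ 1) (hz : z ∈ annulus ‖q ^ 2‖ 1) :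
    heckeSum q x y z = kronecker q x y + z * heckeSum q (q * x) (q * y) z := by
  have hx0 := ne_zero_of_mem_annulus (norm_nonneg _) hx
  have hy0 := ne_zero_of_mem_annulus (norm_nonneg _) hy
  have hz0 := ne_zero_of_mem_annulus (norm_nonneg _) hz
  have hne : ∀ {w : ℂ}, ‖w‖ < 1 → ∀ n : ℕ, 1 - w * q ^ n ≠ 0 := fun {w} hw n h ↦ by
    have hlt := (norm_mul_pow_le hq.le w n).trans_lt hw
    rw [← sub_eq_zero.mp h, norm_one] at hlt
    exact lt_irrefl _ hlt
  have hleft := doubleSum_eq_lambert_add_right_mul hq hx.2 hy.2 (hne hz.2)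
  have hright := doubleSum_eq_lambert_add_right_mul hq (norm_div_lt_one hx.1)
    (norm_div_lt_one hy.1) (hne (norm_div_lt_one hz.1))
  have hdiv : ∀ w, q ^ 2 / (q * w) = q / w := fun w ↦ by rw [pow_two, mul_div_mul_left _ _ hq0]
  have hmul : ∀ w, q * (q / w) = q ^ 2 / w := fun w ↦ by ring
  rw [hmul, hmul] at hright
  rw [heckeSum, heckeSum, kronecker, hdiv, hdiv, hleft, hright]
  field_simp
  ring

lemma heckeSum_base_sq_mul (hq : ‖q‖ < 1) (hq0 : q ≠ 0) {x y z : ℂ} (hx : x ∈ annulus ‖q‖ 1)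
    (hy : y ∈ annulus ‖q‖ 1) (hz : z ∈ annulus 1 ‖q‖⁻¹) :
    heckeSum q x y (q ^ 2 * z) = kronecker q x y
      + q * z / (x * y) * (heckeSum q x y z - kronecker q y z - kronecker q x z) := by
  have hx0 := ne_zero_of_mem_annulus (norm_nonneg _) hx
  have hy0 := ne_zero_of_mem_annulus (norm_nonneg _) hy
  have hz0 := ne_zero_of_mem_annulus zero_le_one hz
  have hqz : ‖q * z‖ < 1 := norm_mul_lt_one_of_norm_lt_inv hz.2
  have hq2z : q ^ 2 * z ∈ annulus ‖q ^ 2‖ 1 := by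
    refine ⟨?_, ?_⟩
    · rw [norm_mul]
      exact lt_mul_of_one_lt_right (norm_pos_iff.mpr (pow_ne_zero 2 hq0)) hz.1
    · rw [pow_two, mul_assoc]
      exact norm_mul_lt_one hq.le hqz
  have hqy : q * y ∈ annulus ‖q ^ 2‖ 1 := by
    refine ⟨?_, norm_mul_lt_one hq.le hy.2⟩
    rw [pow_two, norm_mul, norm_mul]
    exact mul_lt_mul_of_pos_left hy.1 (norm_pos_iff.mpr hq0)
  have hz1 : z ≠ 1 := fun h ↦ (norm_one (α := ℂ) ▸ h ▸ hz.1).false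
  have hright := heckeSum_eq_kronecker_add_right_mul hq hq0 hx hy hq2z
  have hleft := heckeSum_eq_kronecker_add_left_mul hq hq0 (annulus_subset_annulus_sq hq.le hx) hy
    hz0
  have hleft' := heckeSum_eq_kronecker_add_left_mul hq hq0 hqy hx (mul_ne_zero hq0 hz0)
  rw [heckeSum_comm q (q * y), heckeSum_comm q (q * y), ← mul_assoc q q z, ← pow_two] at hleft'
  rw [hright, hleft, hleft', ← kronecker_base_mul hq hx hq0 hz0 hz1]
  field_simp
  ring

lemma exists_differentiableOn_j_mul_kronecker (hq : ‖q‖ < 1) {y : ℂ} (hy : y ∈ annulus ‖q‖ 1) :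
    ∃ f : ℂ → ℂ, DifferentiableOn ℂ f (annulus ‖q‖ ‖q‖⁻¹) ∧ f 1 = J 1 q ^ 3 ∧
      ∀ z, z ≠ 1 → f z = j z q * kronecker q y z := by
  have hy0 := ne_zero_of_mem_annulus (norm_nonneg _) hy
  refine ⟨fun z ↦ jDivOneSub z q + j z q *
    (y * lambert q y (q * z) - q / (y * z) * lambert q (q / y) (q / z)), fun z hz ↦ ?_, ?_, ?_⟩
  · have hz0 := ne_zero_of_mem_annulus (norm_nonneg _) hz
    have hleft :=
      (differentiableAt_lambert hq.le hy.2 (norm_mul_lt_one_of_norm_lt_inv hz.2)).fun_comp' z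
        (f := fun z ↦ q * z) (by fun_prop)
    have hright := (differentiableAt_lambert hq.le (norm_div_lt_one hy.1)
      (norm_div_lt_one hz.1)).fun_comp' z (f := fun z ↦ q / z) (by fun_prop (disch := exact hz0))
    have hcoeff : DifferentiableAt ℂ (fun z ↦ q / (y * z)) z := by
      fun_prop (disch := exact mul_ne_zero hy0 hz0)
    have hj : DifferentiableAt ℂ (fun z ↦ j z q) z := differentiableAt_j hq (by fun_prop) hz0
    exact ((differentiableAt_jDivOneSub hq hz0).add
      (hj.mul ((hleft.const_mul y).sub (hcoeff.mul hright)))).differentiableWithinAt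
  · simp only [j_eq_one_sub_mul hq, jDivOneSub_one, sub_self, zero_mul, add_zero]
  · intro z hz
    have hz' : 1 - z ≠ 0 := sub_ne_zero.mpr hz.symm
    simp only [kronecker, lambert_eq_add hq hy.2 z, j_eq_one_sub_mul hq z]
    field_simp
    ring

lemma j_mul_j_mul_kronecker (hq : ‖q‖ < 1) (hq0 : q ≠ 0) {y z : ℂ} (hy : y ∈ annulus ‖q‖ 1)
    (hz : z ∈ annulus ‖q‖ ‖q‖⁻¹) (hz1 : z ≠ 1) :
    j y q * j z q * kronecker q y z = J 1 q ^ 3 * j (y * z) q := by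
  have hy0 := ne_zero_of_mem_annulus (norm_nonneg _) hy
  have hqpos : 0 < ‖q‖ := norm_pos_iff.mpr hq0
  have hinv : 1 < ‖q‖⁻¹ := (one_lt_inv₀ hqpos).mpr hq
  obtain ⟨f, hf, hf1, hfK⟩ := exists_differentiableOn_j_mul_kronecker hq hy
  obtain ⟨r, hr1, hr2⟩ := exists_between hinv
  have hqr : ‖q‖ * r < 1 := by
    rw [← mul_inv_cancel₀ hqpos.ne']
    exact mul_lt_mul_of_pos_left hr2 hqpos
  have hg : DifferentiableOn ℂ (fun z ↦ j (y * z) q) (annulus ‖q‖ ‖q‖⁻¹) := fun w hw ↦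
    (differentiableAt_j hq (f := fun z ↦ y * z) (by fun_prop)
      (mul_ne_zero hy0 (ne_zero_of_mem_annulus (norm_nonneg _) hw))).differentiableWithinAt
  have hfper : ∀ w : ℂ, ‖w‖ = r → f (q * w) = -y⁻¹ * w⁻¹ * f w := fun w hw ↦ by
    have hw0 : w ≠ 0 := norm_pos_iff.mp (by linarith)
    have hw1 : w ≠ 1 := by rintro rfl; rw [norm_one] at hw; linarith
    have hqw1 : q * w ≠ 1 := fun h ↦ by
      have hnorm := norm_mul q w
      rw [h, norm_one, hw] at hnorm
      linarith
    rw [hfK _ hqw1, hfK _ hw1, j_base_mul hq hq0 hw0, ← kronecker_base_mul hq hy hq0 hw0 hw1]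
    field_simp
  have hgper : ∀ w : ℂ, ‖w‖ = r → j (y * (q * w)) q = -y⁻¹ * w⁻¹ * j (y * w) q := fun w hw ↦ by
    have hw0 : w ≠ 0 := norm_pos_iff.mp (by linarith)
    rw [mul_left_comm, j_base_mul hq hq0 (mul_ne_zero hy0 hw0), mul_inv]
    ring
  have hcross := mul_eq_mul_of_quasiPeriodic hqpos.le hq.le (neg_ne_zero.mpr (inv_ne_zero hy0))
    hf hg (lt_mul_of_one_lt_right hqpos hr1) hr2 hfper hgper hz
    (w := 1) ⟨by rwa [norm_one], by rwa [norm_one]⟩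
  rw [hfK z hz1, hf1, mul_one] at hcross
  linear_combination hcross

/-! ### Sums over octants -/

/-- The summand `q^{rs+rt+st} x^r y^s z^t` of the triple sum, indexed by natural numbers. -/
def octantTerm (q x y z : ℂ) (p : ℕ × ℕ × ℕ) : ℂ :=
  q ^ (p.1 * p.2.1 + p.1 * p.2.2 + p.2.1 * p.2.2) * x ^ p.1 * y ^ p.2.1 * z ^ p.2.2

/-- The part `∑_{r, s, t ≥ 0} q^{rs+rt+st} x^r y^s z^t` of the triple sum. -/
def octantSum (q x y z : ℂ) : ℂ := ∑' p, octantTerm q x y z p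

lemma norm_octantTerm_le (hq : ‖q‖ ≤ 1) {x y z : ℂ} {a b c : ℝ} (hx : ‖x‖ ≤ a) (hy : ‖y‖ ≤ b)
    (hz : ‖z‖ ≤ c) (p : ℕ × ℕ × ℕ) :
    ‖octantTerm q x y z p‖ ≤ a ^ p.1 * (b ^ p.2.1 * c ^ p.2.2) := by
  have ha := (norm_nonneg x).trans hx
  have hb := (norm_nonneg y).trans hy
  rw [octantTerm, mul_assoc, mul_assoc, norm_mul, norm_mul, norm_mul, norm_pow x, norm_pow y,
    norm_pow z]
  refine (mul_le_of_le_one_left (by positivity) ?_).trans (by gcongr)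
  rw [norm_pow]
  exact pow_le_one₀ (norm_nonneg q) hq

lemma summable_pow_mul_pow_mul_pow {a b c : ℝ} (ha0 : 0 ≤ a) (ha : a < 1) (hb0 : 0 ≤ b)
    (hb : b < 1) (hc0 : 0 ≤ c) (hc : c < 1) :
    Summable fun p : ℕ × ℕ × ℕ ↦ a ^ p.1 * (b ^ p.2.1 * c ^ p.2.2) :=
  (summable_geometric_of_lt_one ha0 ha).mul_of_nonneg
    ((summable_geometric_of_lt_one hb0 hb).mul_of_nonneg (summable_geometric_of_lt_one hc0 hc)
      (fun _ ↦ by positivity) fun _ ↦ by positivity)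
    (fun _ ↦ by positivity) fun _ ↦ by positivity

lemma summable_octantTerm (hq : ‖q‖ ≤ 1) {x y z : ℂ} (hx : ‖x‖ < 1) (hy : ‖y‖ < 1)
    (hz : ‖z‖ < 1) : Summable (octantTerm q x y z) :=
  Summable.of_norm_bounded (summable_pow_mul_pow_mul_pow (norm_nonneg x) hx (norm_nonneg y) hy
    (norm_nonneg z) hz) (norm_octantTerm_le hq le_rfl le_rfl le_rfl)

lemma continuousAt_octantSum (hq : ‖q‖ ≤ 1) {x y z : ℂ} (hx : ‖x‖ < 1) (hy : ‖y‖ < 1)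
    (hz : ‖z‖ < 1) :
    ContinuousAt (fun p : ℂ × ℂ × ℂ ↦ octantSum q p.1 p.2.1 p.2.2) (x, y, z) := by
  obtain ⟨a, hxa, ha⟩ := exists_between hx
  obtain ⟨b, hyb, hb⟩ := exists_between hy
  obtain ⟨c, hzc, hc⟩ := exists_between hz
  set U : Set (ℂ × ℂ × ℂ) := Metric.ball 0 a ×ˢ (Metric.ball 0 b ×ˢ Metric.ball 0 c) with hU
  have hU_nhds : U ∈ 𝓝 (x, y, z) :=
    (Metric.isOpen_ball.prod (Metric.isOpen_ball.prod Metric.isOpen_ball)).mem_nhds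
      (by simpa [hU] using ⟨hxa, hyb, hzc⟩)
  refine ContinuousOn.continuousAt (continuousOn_tsum (fun i ↦ ?_) (summable_pow_mul_pow_mul_pow
    ((norm_nonneg x).trans hxa.le) ha ((norm_nonneg y).trans hyb.le) hb
    ((norm_nonneg z).trans hzc.le) hc) fun i p hp ↦ ?_) hU_nhds
  · unfold octantTerm
    fun_prop
  · simp only [hU, Set.mem_prod, mem_ball_zero_iff] at hp
    exact norm_octantTerm_le hq hp.1.le hp.2.1.le hp.2.2.le i

lemma doubleSum_eq_octantSum (hq : ‖q‖ ≤ 1) {x y z : ℂ} (hx : ‖x‖ < 1) (hy : ‖y‖ < 1)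
    (hz : ‖z‖ < 1) : doubleSum q x y z = octantSum q x y z := by
  rw [doubleSum, lambertSeries_eq_tsum hq (summable_norm_pow_mul_pow_mul_pow hq hx hy) _ hz,
    octantSum, ← (Equiv.prodAssoc ℕ ℕ ℕ).tsum_eq]
  refine tsum_congr fun p ↦ ?_
  simp only [octantTerm, Equiv.prodAssoc_apply]
  ring

lemma octantSum_comm_right (q x y z : ℂ) : octantSum q x y z = octantSum q x z y := by
  rw [octantSum, octantSum, ← ((Equiv.refl ℕ).prodCongr (Equiv.prodComm ℕ ℕ)).tsum_eq]
  refine tsum_congr fun p ↦ ?_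
  simp only [octantTerm, Equiv.prodCongr_apply, Prod.map, Equiv.refl_apply, Equiv.prodComm_apply,
    Prod.fst_swap, Prod.snd_swap]
  ring

lemma heckeSum_eq_octantSum (hq : ‖q‖ ≤ 1) {x y z : ℂ} (hx : x ∈ annulus ‖q ^ 2‖ 1)
    (hy : y ∈ annulus ‖q ^ 2‖ 1) (hz : z ∈ annulus ‖q ^ 2‖ 1) :
    heckeSum q x y z = octantSum q x y z
      + q ^ 3 / (x * y * z) * octantSum q (q ^ 2 / x) (q ^ 2 / y) (q ^ 2 / z) := by
  rw [heckeSum, doubleSum_eq_octantSum hq hx.2 hy.2 hz.2, doubleSum_eq_octantSum hq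
    (norm_div_lt_one hx.1) (norm_div_lt_one hy.1) (norm_div_lt_one hz.1)]

lemma heckeSum_comm_right (hq : ‖q‖ ≤ 1) {x y z : ℂ} (hx : x ∈ annulus ‖q ^ 2‖ 1)
    (hy : y ∈ annulus ‖q ^ 2‖ 1) (hz : z ∈ annulus ‖q ^ 2‖ 1) :
    heckeSum q x y z = heckeSum q x z y := by
  rw [heckeSum_eq_octantSum hq hx hy hz, heckeSum_eq_octantSum hq hx hz hy,
    octantSum_comm_right q x, octantSum_comm_right q (q ^ 2 / x), mul_right_comm x]

/-- The parametrization of the nonnegative octant by triples of natural numbers. -/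
def nonnegEquiv : ℕ × ℕ × ℕ ≃ nonnegTriples where
  toFun p := ⟨(p.1, p.2.1, p.2.2), by simp [nonnegTriples]⟩
  invFun p := (p.1.1.toNat, p.1.2.1.toNat, p.1.2.2.toNat)
  left_inv p := by simp
  right_inv p := by
    obtain ⟨⟨r, s, t⟩, hr, hs, ht⟩ := p
    exact Subtype.ext (Prod.ext (Int.toNat_of_nonneg hr) (Prod.ext (Int.toNat_of_nonneg hs)
      (Int.toNat_of_nonneg ht)))

/-- The parametrization of the negative octant by triples of natural numbers, sending `n` to
`-n - 1` in each coordinate. -/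
def negEquiv : ℕ × ℕ × ℕ ≃ negTriples where
  toFun p := ⟨(-p.1 - 1, -p.2.1 - 1, -p.2.2 - 1), by
    refine ⟨?_, ?_, ?_⟩ <;> simp only <;> omega⟩
  invFun p := ((-p.1.1 - 1).toNat, (-p.1.2.1 - 1).toNat, (-p.1.2.2 - 1).toNat)
  left_inv p := by ext <;> simp
  right_inv p := by
    obtain ⟨⟨r, s, t⟩, hr, hs, ht⟩ := p
    simp only at hr hs ht
    refine Subtype.ext (Prod.ext ?_ (Prod.ext ?_ ?_)) <;> simp only <;> omega

lemma term_nonnegEquiv (q x y z : ℂ) (p : ℕ × ℕ × ℕ) :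
    term q x y z (nonnegEquiv p) = octantTerm q x y z p := by
  simp only [term, octantTerm, nonnegEquiv, Equiv.coe_fn_mk]
  norm_cast

lemma zpow_neg_sub_one {x : ℂ} (hx : x ≠ 0) (n : ℕ) : x ^ (-(n : ℤ) - 1) = x⁻¹ * x⁻¹ ^ n := by
  rw [zpow_sub_one₀ hx, zpow_neg, zpow_natCast, inv_pow, mul_comm]

lemma term_negEquiv (q : ℂ) {x y z : ℂ} (hx : x ≠ 0) (hy : y ≠ 0) (hz : z ≠ 0)
    (p : ℕ × ℕ × ℕ) :
    term q x y z (negEquiv p)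
      = q ^ 3 / (x * y * z) * octantTerm q (q ^ 2 / x) (q ^ 2 / y) (q ^ 2 / z) p := by
  obtain ⟨r, s, t⟩ := p
  have hexp : (-(r : ℤ) - 1) * (-(s : ℤ) - 1) + (-(r : ℤ) - 1) * (-(t : ℤ) - 1)
      + (-(s : ℤ) - 1) * (-(t : ℤ) - 1)
      = ((r * s + r * t + s * t + 2 * r + 2 * s + 2 * t + 3 : ℕ) : ℤ) := by
    push_cast
    ring
  simp only [term, octantTerm, negEquiv, Equiv.coe_fn_mk]
  rw [hexp, zpow_natCast, zpow_neg_sub_one hx, zpow_neg_sub_one hy, zpow_neg_sub_one hz]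
  simp only [div_eq_mul_inv, mul_pow, ← pow_mul, pow_add, mul_inv]
  ring

lemma summable_term_nonnegTriples (hq : ‖q‖ ≤ 1) {x y z : ℂ} (hx : ‖x‖ < 1) (hy : ‖y‖ < 1)
    (hz : ‖z‖ < 1) : Summable fun p : nonnegTriples ↦ term q x y z p :=
  nonnegEquiv.summable_iff.mp
    ((summable_octantTerm hq hx hy hz).congr fun p ↦ (term_nonnegEquiv q x y z p).symm)

lemma summable_term_negTriples (hq : ‖q‖ ≤ 1) {x y z : ℂ} (hx : ‖q ^ 2‖ < ‖x‖)
    (hy : ‖q ^ 2‖ < ‖y‖) (hz : ‖q ^ 2‖ < ‖z‖) :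
    Summable fun p : negTriples ↦ term q x y z p := by
  have hne {w : ℂ} (hw : ‖q ^ 2‖ < ‖w‖) : w ≠ 0 := norm_pos_iff.mp ((norm_nonneg _).trans_lt hw)
  exact negEquiv.summable_iff.mp (((summable_octantTerm hq (norm_div_lt_one hx)
    (norm_div_lt_one hy) (norm_div_lt_one hz)).mul_left _).congr
    fun p ↦ (term_negEquiv q (hne hx) (hne hy) (hne hz) p).symm)

lemma tripleSum_eq_octantSum (q : ℂ) {x y z : ℂ} (hx : x ≠ 0) (hy : y ≠ 0) (hz : z ≠ 0) :
    tripleSum q x y z = octantSum q x y z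
      + q ^ 3 / (x * y * z) * octantSum q (q ^ 2 / x) (q ^ 2 / y) (q ^ 2 / z) := by
  rw [tripleSum, ← nonnegEquiv.tsum_eq, ← negEquiv.tsum_eq, octantSum, octantSum,
    ← tsum_mul_left, tsum_congr (term_nonnegEquiv q x y z), tsum_congr (term_negEquiv q hx hy hz)]

lemma tripleSum_eq_heckeSum (hq : ‖q‖ ≤ 1) {x y z : ℂ} (hx : x ∈ annulus ‖q ^ 2‖ 1)
    (hy : y ∈ annulus ‖q ^ 2‖ 1) (hz : z ∈ annulus ‖q ^ 2‖ 1) :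
    tripleSum q x y z = heckeSum q x y z := by
  have hne {w : ℂ} (hw : w ∈ annulus ‖q ^ 2‖ 1) : w ≠ 0 :=
    ne_zero_of_mem_annulus (norm_nonneg _) hw
  rw [heckeSum_eq_octantSum hq hx hy hz, tripleSum_eq_octantSum q (hne hx) (hne hy) (hne hz)]

lemma continuousAt_tripleSum (hq : ‖q‖ ≤ 1) {x y z : ℂ} (hx : x ∈ annulus ‖q ^ 2‖ 1)
    (hy : y ∈ annulus ‖q ^ 2‖ 1) (hz : z ∈ annulus ‖q ^ 2‖ 1) :
    ContinuousAt (fun p : ℂ × ℂ × ℂ ↦ tripleSum q p.1 p.2.1 p.2.2) (x, y, z) := by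
  have hx0 : x ≠ 0 := ne_zero_of_mem_annulus (norm_nonneg _) hx
  have hy0 : y ≠ 0 := ne_zero_of_mem_annulus (norm_nonneg _) hy
  have hz0 : z ≠ 0 := ne_zero_of_mem_annulus (norm_nonneg _) hz
  have hfst : ContinuousAt (fun p : ℂ × ℂ × ℂ ↦ p.1) (x, y, z) := by fun_prop
  have hsnd : ContinuousAt (fun p : ℂ × ℂ × ℂ ↦ p.2.1) (x, y, z) := by fun_prop
  have hthd : ContinuousAt (fun p : ℂ × ℂ × ℂ ↦ p.2.2) (x, y, z) := by fun_prop
  have hreflect : ContinuousAt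
      (fun p : ℂ × ℂ × ℂ ↦ octantSum q (q ^ 2 / p.1) (q ^ 2 / p.2.1) (q ^ 2 / p.2.2)) (x, y, z) :=
    ContinuousAt.comp (g := fun p : ℂ × ℂ × ℂ ↦ octantSum q p.1 p.2.1 p.2.2)
      (f := fun p : ℂ × ℂ × ℂ ↦ (q ^ 2 / p.1, q ^ 2 / p.2.1, q ^ 2 / p.2.2))
      (continuousAt_octantSum hq (norm_div_lt_one hx.1) (norm_div_lt_one hy.1)
        (norm_div_lt_one hz.1))
      ((continuousAt_const.div hfst hx0).prodMk
        ((continuousAt_const.div hsnd hy0).prodMk (continuousAt_const.div hthd hz0)))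
  have hfactor : ContinuousAt (fun p : ℂ × ℂ × ℂ ↦ q ^ 3 / (p.1 * p.2.1 * p.2.2)) (x, y, z) :=
    continuousAt_const.div ((hfst.mul hsnd).mul hthd) (mul_ne_zero (mul_ne_zero hx0 hy0) hz0)
  refine ((continuousAt_octantSum hq hx.2 hy.2 hz.2).add (hfactor.mul hreflect)).congr ?_
  filter_upwards [hfst.eventually_ne hx0, hsnd.eventually_ne hy0, hthd.eventually_ne hz0]
    with p h1 h2 h3
  exact (tripleSum_eq_octantSum q h1 h2 h3).symm

/-! ### The defect of the identity -/

lemma annulus_sq_subset_annulus_sq_inv (hq : ‖q‖ < 1) (hq0 : q ≠ 0) :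
    annulus ‖q ^ 2‖ 1 ⊆ annulus ‖q ^ 2‖ ‖q‖⁻¹ :=
  fun _ hz ↦ ⟨hz.1, hz.2.trans ((one_lt_inv₀ (norm_pos_iff.mpr hq0)).mpr hq)⟩

lemma annulus_inv_subset_annulus_sq_inv (hq : ‖q‖ < 1) (hq0 : q ≠ 0) :
    annulus ‖q ^ 2‖ ‖q‖⁻¹ ⊆ annulus ‖q ^ 2‖ ‖q ^ 2‖⁻¹ := by
  refine fun z hz ↦ ⟨hz.1, hz.2.trans_le ?_⟩
  have hq' := norm_pos_iff.mpr hq0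
  rw [norm_pow]
  exact inv_anti₀ (by positivity) (pow_le_of_le_one hq'.le hq.le two_ne_zero)

lemma self_mem_annulus_sq (hq : ‖q‖ < 1) (hq0 : q ≠ 0) : q ∈ annulus ‖q ^ 2‖ 1 := by
  refine ⟨?_, hq⟩
  rw [norm_pow, sq]
  exact mul_lt_of_lt_one_left (norm_pos_iff.mpr hq0) hq

lemma neg_one_mem_annulus (hq : ‖q‖ < 1) (hq0 : q ≠ 0) : -1 ∈ annulus ‖q ^ 2‖ ‖q‖⁻¹ :=
  neg_mem_annulus.mpr ⟨by simpa using norm_pow_lt_one hq two_ne_zero,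
    by simpa using (one_lt_inv₀ (norm_pos_iff.mpr hq0)).mpr hq⟩

/-- `J_1³ j(w; q) m(-qx/w, q², qw)`, written so that the removable singularity at `w = q` is
filled in. -/
def appellTheta (q x w : ℂ) : ℂ := J 1 q ^ 4 / J 2 q ^ 2 * (j w (q ^ 2) * appell q x w)

lemma J_mul_theta (hq : ‖q‖ < 1) (hq0 : q ≠ 0) {w : ℂ} (hw : w ≠ 0) :
    J 1 q ^ 4 / J 2 q ^ 2 * (j w (q ^ 2) * theta q w) = J 1 q ^ 3 * j w q := by
  have hJ : J 2 q ≠ 0 := J_ne_zero hq two_ne_zero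
  rw [theta_eq_j hq hq0 hw]
  field_simp
  linear_combination -J 1 q ^ 3 * j_mul_J_two_sq hq hq0 w

lemma appellTheta_sq_mul_right (hq : ‖q‖ < 1) (hq0 : q ≠ 0) {x w : ℂ} (hx0 : x ≠ 0)
    (hx : ∀ r : ℤ, 1 + q ^ (2 * r) * x ≠ 0) (hw : w ≠ 0) :
    appellTheta q x (q ^ 2 * w) = (x * w)⁻¹ * (appellTheta q x w - J 1 q ^ 3 * j w q) := by
  have happell : appell q x (q ^ 2 * w) = x⁻¹ * (theta q w - appell q x w) := by
    rw [← appell_sq_mul_right hq hq0 hx0 hx, inv_mul_cancel_left₀ hx0]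
  rw [appellTheta, appellTheta, ← J_mul_theta hq hq0 hw, happell,
    j_base_mul (norm_pow_lt_one hq two_ne_zero) (pow_ne_zero 2 hq0) hw, mul_inv]
  ring

lemma appellTheta_sq_mul_left (hq : ‖q‖ < 1) (hq0 : q ≠ 0) {x w : ℂ} (hx0 : x ≠ 0)
    (hx : ∀ r : ℤ, 1 + q ^ (2 * r) * x ≠ 0) (hw : w ≠ 0) :
    appellTheta q (q ^ 2 * x) w = q * x / w * appellTheta q x w + J 1 q ^ 3 * j w q := by
  rw [appellTheta, appellTheta, ← J_mul_theta hq hq0 hw, appell_sq_mul_left hq hq0 hx0 hx hw]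
  ring

lemma differentiableAt_appellTheta_right (hq : ‖q‖ < 1) (hq0 : q ≠ 0) {x w : ℂ} (hx : x ≠ 0)
    (hw : w ≠ 0) : DifferentiableAt ℂ (fun w ↦ appellTheta q x w) w :=
  ((differentiableAt_j (norm_pow_lt_one hq two_ne_zero) differentiableAt_id hw).mul
    (differentiableAt_appell_right hq hq0 hx hw)).const_mul _

/-- The quotient of theta functions in the last term of the Appell–Lerch side. -/
def thetaQuot (q x y z : ℂ) : ℂ :=
  j (x * y) (q ^ 2) * j (x * z) (q ^ 2) * j (y * z) (q ^ 2)
    / (j (-x) (q ^ 2) * j (-y) (q ^ 2) * j (-z) (q ^ 2))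

lemma thetaQuot_sq_mul (hq : ‖q‖ < 1) (hq0 : q ≠ 0) {x y z : ℂ} (hx : x ≠ 0) (hy : y ≠ 0)
    (hz : z ≠ 0) : thetaQuot q x y (q ^ 2 * z) = (x * y * z)⁻¹ * thetaQuot q x y z := by
  have hj {w : ℂ} (hw : w ≠ 0) : j (q ^ 2 * w) (q ^ 2) = -w⁻¹ * j w (q ^ 2) :=
    j_base_mul (norm_pow_lt_one hq two_ne_zero) (pow_ne_zero 2 hq0) hw
  rw [thetaQuot, thetaQuot, mul_left_comm x, mul_left_comm y, ← mul_neg, hj (mul_ne_zero hx hz),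
    hj (mul_ne_zero hy hz), hj (neg_ne_zero.mpr hz)]
  field_simp

/-- The difference of the two sides of the identity, multiplied by `j(x; q) j(y; q) j(z; q)`. -/
def defect (q x y z : ℂ) : ℂ :=
  j x q * j y q * j z q * heckeSum q x y z
  - (j x q * appellTheta q x (y * z) + j y q * appellTheta q y (x * z)
    + j z q * appellTheta q z (x * y))
  + 2 * (J 1 q ^ 3 * J 2 q ^ 3) * thetaQuot q x y z

lemma defect_swap_left (q x y z : ℂ) : defect q x y z = defect q y x z := by
  rw [defect, defect, thetaQuot, thetaQuot, heckeSum_comm q x y, mul_comm x y]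
  ring

lemma defect_swap_right (hq : ‖q‖ ≤ 1) {x y z : ℂ} (hx : x ∈ annulus ‖q ^ 2‖ 1)
    (hy : y ∈ annulus ‖q ^ 2‖ 1) (hz : z ∈ annulus ‖q ^ 2‖ 1) :
    defect q x y z = defect q x z y := by
  rw [defect, defect, thetaQuot, thetaQuot, heckeSum_comm_right hq hx hy hz, mul_comm y z]
  ring

lemma defect_sq_mul (hq : ‖q‖ < 1) (hq0 : q ≠ 0) {x y z : ℂ} (hx : x ∈ annulus ‖q‖ 1)
    (hy : y ∈ annulus ‖q‖ 1) (hz : z ∈ annulus 1 ‖q‖⁻¹) :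
    defect q x y (q ^ 2 * z) = (x * y)⁻¹ * z⁻¹ * defect q x y z := by
  have hx0 := ne_zero_of_mem_annulus (norm_nonneg _) hx
  have hy0 := ne_zero_of_mem_annulus (norm_nonneg _) hy
  have hz0 := ne_zero_of_mem_annulus zero_le_one hz
  have hinv : 1 < ‖q‖⁻¹ := (one_lt_inv₀ (norm_pos_iff.mpr hq0)).mpr hq
  have hq2 := norm_pow_lt_one hq two_ne_zero
  have hden {w : ℂ} (hw : w ∈ annulus ‖q ^ 2‖ ‖q‖⁻¹) (hw1 : ‖w‖ ≠ 1) (r : ℤ) :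
      1 + q ^ (2 * r) * w ≠ 0 :=
    one_add_zpow_mul_ne_zero hq (annulus_inv_subset_annulus_sq_inv hq hq0 hw) hq0
      (by rintro rfl; simp at hw1) r
  have hden' {w : ℂ} (hw : w ∈ annulus ‖q‖ 1) := hden (annulus_sq_subset_annulus_sq_inv hq hq0
    (annulus_subset_annulus_sq hq.le hw)) hw.2.ne
  have hz' : z ∈ annulus ‖q‖ ‖q‖⁻¹ := ⟨hq.trans hz.1, hz.2⟩
  have hz1 : z ≠ 1 := by rintro rfl; simp [annulus] at hz
  have kxy := j_mul_j_mul_kronecker hq hq0 hx ⟨hy.1, hy.2.trans hinv⟩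
    (by rintro rfl; simp [annulus] at hy)
  have kxz := j_mul_j_mul_kronecker hq hq0 hx hz' hz1
  have kyz := j_mul_j_mul_kronecker hq hq0 hy hz' hz1
  have hfactor : q⁻¹ * (z ^ 2)⁻¹ * (q * z / (x * y)) = (x * y * z)⁻¹ := by field_simp
  rw [defect, defect, heckeSum_base_sq_mul hq hq0 hx hy hz, j_base_sq_mul hq hq0 hz0,
    thetaQuot_sq_mul hq hq0 hx0 hy0 hz0, mul_left_comm x, mul_left_comm y,
    appellTheta_sq_mul_right hq hq0 hx0 (hden' hx) (mul_ne_zero hy0 hz0),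
    appellTheta_sq_mul_right hq hq0 hy0 (hden' hy) (mul_ne_zero hx0 hz0),
    appellTheta_sq_mul_left hq hq0 hz0 (hden ⟨hq2.trans hz.1, hz.2⟩ hz.1.ne')
      (mul_ne_zero hx0 hy0), ← mul_inv (x * y), mul_left_comm y x z, ← mul_assoc x y z]
  generalize q⁻¹ * (z ^ 2)⁻¹ = u at *
  generalize (x * y * z)⁻¹ = t at *
  linear_combination u * j z q * kxy - t * j x q * kyz - t * j y q * kxz
    + j z q * (j x q * j y q * (heckeSum q x y z - kronecker q y z - kronecker q x z)
      - appellTheta q z (x * y)) * hfactor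

lemma exists_differentiableOn_j_mul_heckeSum (hq : ‖q‖ < 1) {x y : ℂ}
    (hx : x ∈ annulus ‖q ^ 2‖ 1) (hy : y ∈ annulus ‖q ^ 2‖ 1) :
    ∃ f : ℂ → ℂ, DifferentiableOn ℂ f (annulus ‖q ^ 2‖ ‖q‖⁻¹) ∧
      ∀ z, z ≠ 1 → f z = j z q * heckeSum q x y z := by
  have hx0 := ne_zero_of_mem_annulus (norm_nonneg _) hx
  have hy0 := ne_zero_of_mem_annulus (norm_nonneg _) hy
  refine ⟨fun z ↦ jDivOneSub z q + j z q * (y * lambert q y (q * z)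
    + x * doubleSum q x (q * y) (q * z)
    + q ^ 3 / (x * y * z) * doubleSum q (q ^ 2 / x) (q ^ 2 / y) (q ^ 2 / z)), fun z hz ↦ ?_, ?_⟩
  · have hz0 := ne_zero_of_mem_annulus (norm_nonneg _) hz
    have hqz : ‖q * z‖ < 1 := norm_mul_lt_one_of_norm_lt_inv hz.2
    have hlambert := (differentiableAt_lambert hq.le hy.2 hqz).fun_comp' z
      (f := fun z ↦ q * z) (by fun_prop)
    have hdouble := (differentiableAt_doubleSum hq.le hx.2 (norm_mul_lt_one hq.le hy.2)
      hqz).fun_comp' z (f := fun z ↦ q * z) (by fun_prop)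
    have hreflect := (differentiableAt_doubleSum hq.le (norm_div_lt_one hx.1)
      (norm_div_lt_one hy.1) (norm_div_lt_one hz.1)).fun_comp' z
      (f := fun z ↦ q ^ 2 / z) (by fun_prop (disch := exact hz0))
    have hcoeff : DifferentiableAt ℂ (fun z ↦ q ^ 3 / (x * y * z)) z := by
      fun_prop (disch := exact mul_ne_zero (mul_ne_zero hx0 hy0) hz0)
    have hj : DifferentiableAt ℂ (fun z ↦ j z q) z := differentiableAt_j hq (by fun_prop) hz0
    exact ((differentiableAt_jDivOneSub hq hz0).add (hj.mul (((hlambert.const_mul y).add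
      (hdouble.const_mul x)).add (hcoeff.mul hreflect)))).differentiableWithinAt
  · intro z hz1
    have hpole : j z q * (1 / (1 - z)) = jDivOneSub z q := by
      rw [j_eq_one_sub_mul hq, mul_one_div, mul_div_cancel_left₀ _ (sub_ne_zero.mpr hz1.symm)]
    rw [heckeSum, doubleSum_eq_lambert_add_left_mul hq hx.2 hy.2, lambert_eq_add hq hy.2 z]
    linear_combination -hpole

lemma exists_differentiableOn_eq_div_sub {U : Set ℂ} (hU : IsOpen U) {g : ℂ → ℂ} {c : ℂ}
    (hc : c ∈ U) (hg : DifferentiableOn ℂ g U) (hgc : g c = 0) :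
    ∃ f : ℂ → ℂ, DifferentiableOn ℂ f U ∧ ∀ z, z ≠ c → f z = g z / (z - c) := by
  refine ⟨dslope g c, (Complex.differentiableOn_dslope (hU.mem_nhds hc)).mpr hg, fun z hz ↦ ?_⟩
  rw [dslope_of_ne _ hz, slope_def_field, hgc, sub_zero]

/-- The coefficient of `1 / (1 + z)` in the two parts of `defect` that have a pole at `z = -1`. -/
def polarPart (q x y z : ℂ) : ℂ :=
  j (x * y) (q ^ 2) * (2 * (J 1 q ^ 3 * J 2 q ^ 3) * (j (x * z) (q ^ 2) * j (y * z) (q ^ 2)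
    / (j (-x) (q ^ 2) * j (-y) (q ^ 2) * jDivOneSub (-z) (q ^ 2))) - J 1 q ^ 4 / J 2 q ^ 2 * j z q)

lemma polarPart_neg_one (hq : ‖q‖ < 1) {x y : ℂ} (hx : x ∈ annulus ‖q ^ 2‖ 1)
    (hy : y ∈ annulus ‖q ^ 2‖ 1) : polarPart q x y (-1) = 0 := by
  have hq2 := norm_pow_lt_one hq two_ne_zero
  have hjx : j (-x) (q ^ 2) ≠ 0 := j_ne_zero hq2 (neg_mem_annulus.mpr hx)
  have hjy : j (-y) (q ^ 2) ≠ 0 := j_ne_zero hq2 (neg_mem_annulus.mpr hy)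
  have hJ : J 2 q ≠ 0 := J_ne_zero hq two_ne_zero
  have hone : jDivOneSub 1 (q ^ 2) = J 2 q ^ 3 := by rw [jDivOneSub_one, J, J, pow_one]
  rw [polarPart, neg_neg, hone, mul_neg_one, mul_neg_one]
  field_simp
  linear_combination -j (x * y) (q ^ 2) * J 1 q ^ 3 * j_neg_one_mul_J_one hq

lemma differentiableOn_polarPart (hq : ‖q‖ < 1) (hq0 : q ≠ 0) {x y : ℂ}
    (hx : x ∈ annulus ‖q ^ 2‖ 1) (hy : y ∈ annulus ‖q ^ 2‖ 1) :
    DifferentiableOn ℂ (polarPart q x y) (annulus ‖q ^ 2‖ ‖q‖⁻¹) := by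
  intro z hz
  have hq2 := norm_pow_lt_one hq two_ne_zero
  have hx0 := ne_zero_of_mem_annulus (norm_nonneg _) hx
  have hy0 := ne_zero_of_mem_annulus (norm_nonneg _) hy
  have hz0 := ne_zero_of_mem_annulus (norm_nonneg _) hz
  have hjz : DifferentiableAt ℂ (fun z ↦ j z q) z := differentiableAt_j hq differentiableAt_id hz0
  have hj {c : ℂ} (hc : c ≠ 0) : DifferentiableAt ℂ (fun z ↦ j (c * z) (q ^ 2)) z :=
    differentiableAt_j hq2 (differentiableAt_id.const_mul c) (mul_ne_zero hc hz0)
  have hreg : DifferentiableAt ℂ (fun z ↦ jDivOneSub (-z) (q ^ 2)) z :=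
    (differentiableAt_jDivOneSub hq2 (neg_ne_zero.mpr hz0)).fun_comp' z differentiableAt_id.neg
  have hden : j (-x) (q ^ 2) * j (-y) (q ^ 2) * jDivOneSub (-z) (q ^ 2) ≠ 0 :=
    mul_ne_zero (mul_ne_zero (j_ne_zero hq2 (neg_mem_annulus.mpr hx))
      (j_ne_zero hq2 (neg_mem_annulus.mpr hy))) (jDivOneSub_ne_zero hq2
      (neg_mem_annulus.mpr (annulus_inv_subset_annulus_sq_inv hq hq0 hz)))
  exact (((((hj hx0).mul (hj hy0)).div (hreg.const_mul _) hden).const_mul _).sub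
    (hjz.const_mul _)).const_mul _ |>.differentiableWithinAt

lemma exists_differentiableOn_thetaQuot_sub_appellTheta (hq : ‖q‖ < 1) (hq0 : q ≠ 0) {x y : ℂ}
    (hx : x ∈ annulus ‖q ^ 2‖ 1) (hy : y ∈ annulus ‖q ^ 2‖ 1) :
    ∃ f : ℂ → ℂ, DifferentiableOn ℂ f (annulus ‖q ^ 2‖ ‖q‖⁻¹) ∧
      ∀ z ∈ annulus ‖q ^ 2‖ ‖q‖⁻¹, z ≠ -1 →
        f z = 2 * (J 1 q ^ 3 * J 2 q ^ 3) * thetaQuot q x y z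
          - j z q * appellTheta q z (x * y) := by
  have hsub := annulus_inv_subset_annulus_sq_inv hq hq0
  obtain ⟨g, hg, hgeq⟩ := exists_differentiableOn_appell_eq hq hq0 (x * y)
  obtain ⟨h, hh, hheq⟩ := exists_differentiableOn_eq_div_sub (isOpen_annulus _ _)
    (neg_one_mem_annulus hq hq0) (differentiableOn_polarPart hq hq0 hx hy)
    (polarPart_neg_one hq hx hy)
  have hj : DifferentiableOn ℂ (fun z ↦ j z q) (annulus ‖q ^ 2‖ ‖q‖⁻¹) := fun z hz ↦
    (differentiableAt_j hq differentiableAt_id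
      (ne_zero_of_mem_annulus (norm_nonneg _) hz)).differentiableWithinAt
  refine ⟨fun z ↦ h z - J 1 q ^ 4 / J 2 q ^ 2 * j (x * y) (q ^ 2) * (j z q * g z),
    hh.sub ((hj.mul (hg.mono hsub)).const_mul _), fun z hz hz1 ↦ ?_⟩
  have hquot : thetaQuot q x y z = j (x * y) (q ^ 2) * (j (x * z) (q ^ 2) * j (y * z) (q ^ 2)
      / (j (-x) (q ^ 2) * j (-y) (q ^ 2) * jDivOneSub (-z) (q ^ 2))) / (1 + z) := by
    rw [thetaQuot, j_eq_one_sub_mul (norm_pow_lt_one hq two_ne_zero) (-z), ← mul_div_assoc,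
      div_div, sub_neg_eq_add]
    ring
  beta_reduce
  rw [hheq z hz1, polarPart, appellTheta, hgeq z (hsub hz), hquot, sub_neg_eq_add, add_comm z]
  ring

lemma exists_differentiableOn_defect (hq : ‖q‖ < 1) (hq0 : q ≠ 0) {x y : ℂ}
    (hx : x ∈ annulus ‖q ^ 2‖ 1) (hy : y ∈ annulus ‖q ^ 2‖ 1) :
    ∃ f : ℂ → ℂ, DifferentiableOn ℂ f (annulus ‖q ^ 2‖ ‖q‖⁻¹) ∧
      ∀ z ∈ annulus ‖q ^ 2‖ ‖q‖⁻¹, ‖z‖ ≠ 1 → f z = defect q x y z := by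
  have hx0 := ne_zero_of_mem_annulus (norm_nonneg _) hx
  have hy0 := ne_zero_of_mem_annulus (norm_nonneg _) hy
  obtain ⟨f, hf, hfeq⟩ := exists_differentiableOn_j_mul_heckeSum hq hx hy
  obtain ⟨g, hg, hgeq⟩ := exists_differentiableOn_thetaQuot_sub_appellTheta hq hq0 hx hy
  have happell {a c : ℂ} (ha : a ≠ 0) (hc : c ≠ 0) :
      DifferentiableOn ℂ (fun z ↦ appellTheta q a (c * z)) (annulus ‖q ^ 2‖ ‖q‖⁻¹) := fun z hz ↦
    ((differentiableAt_appellTheta_right hq hq0 ha (mul_ne_zero hc (ne_zero_of_mem_annulus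
      (norm_nonneg _) hz))).fun_comp' z (differentiableAt_id.const_mul c)).differentiableWithinAt
  refine ⟨fun z ↦ j x q * j y q * f z
    - (j x q * appellTheta q x (y * z) + j y q * appellTheta q y (x * z)) + g z,
    ((hf.const_mul _).sub (((happell hx0 hy0).const_mul _).add
      ((happell hy0 hx0).const_mul _))).add hg, fun z hz hz1 ↦ ?_⟩
  beta_reduce
  rw [hfeq z (by rintro rfl; simp at hz1), hgeq z hz (by rintro rfl; simp at hz1), defect]
  ring

lemma continuousAt_defect (hq : ‖q‖ < 1) (hq0 : q ≠ 0) {x y z : ℂ} (hx : x ∈ annulus ‖q ^ 2‖ 1)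
    (hy : y ∈ annulus ‖q ^ 2‖ 1) (hz : z ∈ annulus ‖q ^ 2‖ 1) :
    ContinuousAt (fun z ↦ defect q x y z) z := by
  obtain ⟨f, hf, hfeq⟩ := exists_differentiableOn_defect hq hq0 hx hy
  have hsub := annulus_sq_subset_annulus_sq_inv hq hq0
  refine (hf.differentiableAt ((isOpen_annulus _ _).mem_nhds (hsub hz))).continuousAt.congr ?_
  filter_upwards [(isOpen_annulus _ _).mem_nhds hz] with u hu
  exact hfeq u (hsub hu) hu.2.ne

lemma defect_mul_eq (hq : ‖q‖ < 1) (hq0 : q ≠ 0) {x y z w : ℂ} (hx : x ∈ annulus ‖q‖ 1)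
    (hy : y ∈ annulus ‖q‖ 1) (hz : z ∈ annulus ‖q ^ 2‖ 1) (hw : w ∈ annulus ‖q ^ 2‖ 1) :
    defect q x y z * j (-(x * y) * w) (q ^ 2) = defect q x y w * j (-(x * y) * z) (q ^ 2) := by
  have hq2 := norm_pow_lt_one hq two_ne_zero
  have hq2pos : 0 < ‖q ^ 2‖ := norm_pos_iff.mpr (pow_ne_zero 2 hq0)
  have hxy : x * y ≠ 0 := mul_ne_zero (ne_zero_of_mem_annulus (norm_nonneg _) hx)
    (ne_zero_of_mem_annulus (norm_nonneg _) hy)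
  have hsub := annulus_sq_subset_annulus_sq_inv hq hq0
  obtain ⟨f, hf, hfeq⟩ := exists_differentiableOn_defect hq hq0
    (annulus_subset_annulus_sq hq.le hx) (annulus_subset_annulus_sq hq.le hy)
  obtain ⟨r, hr1, hr⟩ := exists_between ((one_lt_inv₀ (norm_pos_iff.mpr hq0)).mpr hq)
  have hg : DifferentiableOn ℂ (fun z ↦ j (-(x * y) * z) (q ^ 2)) (annulus ‖q ^ 2‖ ‖q‖⁻¹) :=
    fun u hu ↦ (differentiableAt_j hq2 (differentiableAt_id.const_mul _) (mul_ne_zero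
      (neg_ne_zero.mpr hxy) (ne_zero_of_mem_annulus (norm_nonneg _) hu))).differentiableWithinAt
  have hfper : ∀ u : ℂ, ‖u‖ = r → f (q ^ 2 * u) = (x * y)⁻¹ * u⁻¹ * f u := fun u hu ↦ by
    have hu1 : u ∈ annulus 1 ‖q‖⁻¹ := ⟨hu ▸ hr1, hu ▸ hr⟩
    have hqu : q ^ 2 * u ∈ annulus ‖q ^ 2‖ 1 := by
      refine ⟨by rw [norm_mul]; exact lt_mul_of_one_lt_right hq2pos hu1.1, ?_⟩
      rw [sq, mul_assoc]
      exact norm_mul_lt_one hq.le (norm_mul_lt_one_of_norm_lt_inv hu1.2)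
    rw [hfeq u ⟨hq2.trans hu1.1, hu1.2⟩ hu1.1.ne', hfeq _ (hsub hqu) hqu.2.ne,
      defect_sq_mul hq hq0 hx hy hu1]
  have hgper : ∀ u : ℂ, ‖u‖ = r →
      j (-(x * y) * (q ^ 2 * u)) (q ^ 2) = (x * y)⁻¹ * u⁻¹ * j (-(x * y) * u) (q ^ 2) :=
    fun u hu ↦ by
      have hu0 : u ≠ 0 := norm_pos_iff.mp (hu ▸ zero_lt_one.trans hr1)
      rw [mul_left_comm, j_base_mul hq2 (pow_ne_zero 2 hq0) (mul_ne_zero (neg_ne_zero.mpr hxy) hu0),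
        mul_inv, inv_neg]
      ring
  have hcross := mul_eq_mul_of_quasiPeriodic (norm_nonneg _) hq2.le (inv_ne_zero hxy) hf hg
    (lt_mul_of_one_lt_right hq2pos hr1) hr hfper hgper (hsub hz) (hsub hw)
  rwa [hfeq z (hsub hz) hz.2.ne, hfeq w (hsub hw) hw.2.ne] at hcross

lemma defect_self_self (hq : ‖q‖ < 1) (hq0 : q ≠ 0) (y : ℂ) : defect q q y q = 0 := by
  have hj := j_self (norm_pow_lt_one hq two_ne_zero) (pow_ne_zero 2 hq0)
  rw [defect, thetaQuot, appellTheta.eq_def q y, ← sq q, hj, j_self hq hq0]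
  ring

lemma self_mem_closure_annulus (hq : ‖q‖ < 1) (hq0 : q ≠ 0) : q ∈ closure (annulus ‖q‖ 1) := by
  have hlim : Tendsto (fun t : ℝ ↦ (t : ℂ) * q) (𝓝[>] 1) (𝓝 q) := by
    have hcont : Continuous fun t : ℝ ↦ (t : ℂ) * q := by fun_prop
    simpa using (hcont.tendsto 1).mono_left nhdsWithin_le_nhds
  refine mem_closure_of_tendsto hlim ?_
  filter_upwards [self_mem_nhdsWithin, hlim.norm.eventually_lt_const hq] with t ht ht1
  refine ⟨?_, ht1⟩
  rw [norm_mul, Complex.norm_real]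
  exact lt_mul_of_one_lt_left (norm_pos_iff.mpr hq0) (ht.trans_le (le_abs_self t))

lemma defect_self_mul_eq (hq : ‖q‖ < 1) (hq0 : q ≠ 0) {x y w : ℂ} (hx : x ∈ annulus ‖q ^ 2‖ 1)
    (hy : y ∈ annulus ‖q‖ 1) (hw : w ∈ annulus ‖q ^ 2‖ 1) :
    defect q x y q * j (-(y * q) * w) (q ^ 2) = defect q w y q * j (-(y * q) * x) (q ^ 2) := by
  have hq2 := norm_pow_lt_one hq two_ne_zero
  have hy' := annulus_subset_annulus_sq hq.le hy
  have hy0 := ne_zero_of_mem_annulus (norm_nonneg _) hy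
  have hqmem := self_mem_annulus_sq hq hq0
  have hswap {u p : ℂ} (hu : u ∈ annulus ‖q ^ 2‖ 1) (hp : p ∈ annulus ‖q‖ 1) :
      defect q y p u = defect q u y p := by
    rw [defect_swap_right hq.le hy' (annulus_subset_annulus_sq hq.le hp) hu, defect_swap_left]
  have hcont {u v : ℂ} (hu : u ∈ annulus ‖q ^ 2‖ 1) (hv : v ≠ 0) :
      ContinuousAt (fun p ↦ defect q u y p * j (-(y * p) * v) (q ^ 2)) q :=
    (continuousAt_defect hq hq0 hu hy' hqmem).mul (differentiableAt_j hq2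
      (f := fun p ↦ -(y * p) * v) (by fun_prop)
      (mul_ne_zero (neg_ne_zero.mpr (mul_ne_zero hy0 hq0)) hv)).continuousAt
  have : (𝓝[annulus ‖q‖ 1] q).NeBot :=
    mem_closure_iff_nhdsWithin_neBot.mp (self_mem_closure_annulus hq hq0)
  refine tendsto_nhds_unique_of_eventuallyEq (l := 𝓝[annulus ‖q‖ 1] q)
    ((hcont hx (ne_zero_of_mem_annulus (norm_nonneg _) hw)).tendsto.mono_left nhdsWithin_le_nhds)
    ((hcont hw (ne_zero_of_mem_annulus (norm_nonneg _) hx)).tendsto.mono_left nhdsWithin_le_nhds) ?_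
  filter_upwards [self_mem_nhdsWithin] with p hp
  rw [← hswap hx hp, ← hswap hw hp, defect_mul_eq hq hq0 hy hp hx hw]

lemma defect_self_right (hq : ‖q‖ < 1) (hq0 : q ≠ 0) {x y : ℂ} (hx : x ∈ annulus ‖q ^ 2‖ 1)
    (hy : y ∈ annulus ‖q‖ 1) : defect q x y q = 0 := by
  have hq2 := norm_pow_lt_one hq two_ne_zero
  have hy0 : -y ≠ 0 := neg_ne_zero.mpr (ne_zero_of_mem_annulus (norm_nonneg _) hy)
  have hcross := defect_self_mul_eq hq hq0 hx hy (self_mem_annulus_sq hq hq0)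
  rw [defect_self_self hq hq0, zero_mul] at hcross
  refine (mul_eq_zero.mp hcross).resolve_right ?_
  rw [show -(y * q) * q = q ^ 2 * -y by ring, j_base_mul hq2 (pow_ne_zero 2 hq0) hy0]
  exact mul_ne_zero (neg_ne_zero.mpr (inv_ne_zero hy0))
    (j_ne_zero hq2 (neg_mem_annulus.mpr (annulus_subset_annulus_sq hq.le hy)))

lemma j_mul_sq_ne_zero (hq : ‖q‖ < 1) (hq0 : q ≠ 0) {w : ℂ} (hw : w ∈ annulus ‖q ^ 2‖ 1)
    (hwq : w ≠ q) : j (q * w) (q ^ 2) ≠ 0 := by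
  have hqpos : 0 < ‖q‖ := norm_pos_iff.mpr hq0
  have hq2 := norm_pow_lt_one hq two_ne_zero
  have hne : w / q ≠ 0 := div_ne_zero (ne_zero_of_mem_annulus (norm_nonneg _) hw) hq0
  have hmem : w / q ∈ annulus ‖q ^ 2‖ ‖q ^ 2‖⁻¹ := by
    refine ⟨?_, ?_⟩
    · rw [norm_div, lt_div_iff₀ hqpos]
      exact (mul_le_of_le_one_right (norm_nonneg _) hq.le).trans_lt hw.1
    · rw [norm_div, norm_pow, ← one_div, div_lt_div_iff₀ hqpos (by positivity), one_mul, sq,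
        ← mul_assoc]
      exact mul_lt_of_lt_one_left hqpos (mul_lt_one_of_nonneg_of_lt_one_left (norm_nonneg w) hw.2
        hq.le)
  rw [show q * w = q ^ 2 * (w / q) by field_simp, j_base_mul hq2 (pow_ne_zero 2 hq0) hne,
    j_eq_one_sub_mul hq2]
  exact mul_ne_zero (neg_ne_zero.mpr (inv_ne_zero hne)) (mul_ne_zero
    (sub_ne_zero.mpr fun h ↦ hwq ((div_eq_one_iff_eq hq0).mp h.symm)) (jDivOneSub_ne_zero hq2 hmem))

lemma defect_eq_zero_of_ne (hq : ‖q‖ < 1) (hq0 : q ≠ 0) {x y z : ℂ} (hx : x ∈ annulus ‖q‖ 1)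
    (hy : y ∈ annulus ‖q‖ 1) (hz : z ∈ annulus ‖q‖ 1) (hxz : x * z ≠ -q) :
    defect q x y z = 0 := by
  have hx' := annulus_subset_annulus_sq hq.le hx
  have hy' := annulus_subset_annulus_sq hq.le hy
  have hcross := defect_mul_eq hq hq0 hx hz hy' (self_mem_annulus_sq hq hq0)
  rw [defect_self_right hq hq0 hx' hz, zero_mul, mul_comm _ q] at hcross
  rw [defect_swap_right hq.le hx' hy' (annulus_subset_annulus_sq hq.le hz)]
  exact (mul_eq_zero.mp hcross).resolve_right (j_mul_sq_ne_zero hq hq0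
    (neg_mem_annulus.mpr (mul_mem_annulus_sq hx hz)) fun h ↦ hxz (neg_eq_iff_eq_neg.mp h))

lemma defect_eq_zero (hq : ‖q‖ < 1) (hq0 : q ≠ 0) {x y z : ℂ} (hx : x ∈ annulus ‖q‖ 1)
    (hy : y ∈ annulus ‖q‖ 1) (hz : z ∈ annulus ‖q‖ 1) : defect q x y z = 0 := by
  by_cases hxz : x * z = -q
  · have hcont := continuousAt_defect hq hq0 (annulus_subset_annulus_sq hq.le hx)
      (annulus_subset_annulus_sq hq.le hy) (annulus_subset_annulus_sq hq.le hz)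
    refine tendsto_nhds_unique_of_eventuallyEq
      (hcont.mono_left (nhdsWithin_le_nhds (s := {z}ᶜ))) tendsto_const_nhds ?_
    filter_upwards [self_mem_nhdsWithin,
      nhdsWithin_le_nhds ((isOpen_annulus ‖q‖ 1).mem_nhds hz)] with u huz hu
    exact defect_eq_zero_of_ne hq hq0 hx hy hu fun h ↦ huz
      (mul_left_cancel₀ (ne_zero_of_mem_annulus (norm_nonneg _) hx) (h.trans hxz.symm))
  · exact defect_eq_zero_of_ne hq hq0 hx hy hz hxz

/-! ### The Appell–Lerch form -/

lemma m_eq_appell (hq0 : q ≠ 0) (x : ℂ) {w : ℂ} (hw : w ≠ 0) :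
    m (-(q * x / w)) (q ^ 2) (q * w) = 1 / j (q * w) (q ^ 2) * appell q x w := by
  rw [m, appell]
  congr 1
  refine tsum_congr fun r ↦ ?_
  have hbinom : (q ^ 2) ^ (r * (r - 1) / 2) = q ^ (r * (r - 1)) := by
    rw [← zpow_natCast, ← zpow_mul]
    congr 1
    exact Int.mul_ediv_cancel' (Int.even_mul_pred_self r).two_dvd
  have hshift : (q ^ 2) ^ (r - 1) * (q * q) = q ^ (2 * r) := by
    rw [← sq, ← zpow_add_one₀ (pow_ne_zero 2 hq0), sub_add_cancel, ← zpow_natCast, ← zpow_mul,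
      Nat.cast_ofNat]
  have hnum : (-1 : ℂ) ^ r * (q ^ 2) ^ (r * (r - 1) / 2) * (q * w) ^ r = thetaTerm q w r := by
    rw [thetaTerm, hbinom, mul_zpow, show r ^ 2 = r * (r - 1) + r by ring, zpow_add₀ hq0]
    ring
  have hden : 1 - (q ^ 2) ^ (r - 1) * -(q * x / w) * (q * w) = 1 + q ^ (2 * r) * x := by
    rw [← hshift]
    field_simp
    ring
  rw [hnum, hden]

lemma J_mul_j_mul_m_eq_appellTheta (hq : ‖q‖ < 1) (hq0 : q ≠ 0) (x : ℂ) {w : ℂ}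
    (hw : w ∈ annulus ‖q ^ 2‖ 1) (hwq : w ≠ q) :
    J 1 q ^ 3 * j w q * m (-(q * x / w)) (q ^ 2) (q * w) = appellTheta q x w := by
  have hj := j_mul_sq_ne_zero hq hq0 hw hwq
  have hJ : J 2 q ≠ 0 := J_ne_zero hq two_ne_zero
  rw [m_eq_appell hq0 x (ne_zero_of_mem_annulus (norm_nonneg _) hw), appellTheta]
  field_simp
  linear_combination J 1 q ^ 3 * appell q x w * j_mul_J_two_sq hq hq0 w

lemma tripleSum_eq_appellLerchSide (hq : ‖q‖ < 1) (hq0 : q ≠ 0) {x y z : ℂ}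
    (hx : x ∈ annulus ‖q‖ 1) (hy : y ∈ annulus ‖q‖ 1) (hz : z ∈ annulus ‖q‖ 1)
    (hreg : (x, y, z) ∈ regularPoints q) :
    tripleSum q x y z = appellLerchSide q x y z := by
  obtain ⟨hxy, hxz, hyz⟩ := hreg
  have hsub := annulus_subset_annulus_sq hq.le
  have hjx := j_ne_zero hq hx
  have hjy := j_ne_zero hq hy
  have hjz := j_ne_zero hq hz
  have hdefect := defect_eq_zero hq hq0 hx hy hz
  rw [defect, ← J_mul_j_mul_m_eq_appellTheta hq hq0 x (mul_mem_annulus_sq hy hz) hyz,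
    ← J_mul_j_mul_m_eq_appellTheta hq hq0 y (mul_mem_annulus_sq hx hz) hxz,
    ← J_mul_j_mul_m_eq_appellTheta hq hq0 z (mul_mem_annulus_sq hx hy) hxy] at hdefect
  rw [tripleSum_eq_heckeSum hq.le (hsub hx) (hsub hy) (hsub hz), appellLerchSide, ← thetaQuot,
    mul_assoc q y z, mul_assoc q x y, mul_assoc q x z]
  generalize m (-(q * x / (y * z))) (q ^ 2) (q * (y * z)) = mx at *
  generalize m (-(q * y / (x * z))) (q ^ 2) (q * (x * z)) = my at *
  generalize m (-(q * z / (x * y))) (q ^ 2) (q * (x * y)) = mz at *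
  generalize j (y * z) q = jyz at *
  generalize j (x * z) q = jxz at *
  generalize j (x * y) q = jxy at *
  field_simp
  linear_combination hdefect

lemma tendsto_appellLerchSide (hq : ‖q‖ < 1) (hq0 : q ≠ 0) {x y z : ℂ}
    (hx : x ∈ annulus ‖q‖ 1) (hy : y ∈ annulus ‖q‖ 1) (hz : z ∈ annulus ‖q‖ 1) :
    Tendsto (fun p : ℂ × ℂ × ℂ ↦ appellLerchSide q p.1 p.2.1 p.2.2)
      (𝓝[regularPoints q] (x, y, z)) (𝓝 (tripleSum q x y z)) := by
  have hsub := annulus_subset_annulus_sq hq.le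
  have hnhds : annulus ‖q‖ 1 ×ˢ annulus ‖q‖ 1 ×ˢ annulus ‖q‖ 1 ∈ 𝓝 (x, y, z) :=
    ((isOpen_annulus _ _).prod ((isOpen_annulus _ _).prod (isOpen_annulus _ _))).mem_nhds
      ⟨hx, hy, hz⟩
  refine ((continuousAt_tripleSum hq.le (hsub hx) (hsub hy) (hsub hz)).tendsto.mono_left
    nhdsWithin_le_nhds).congr' ?_
  filter_upwards [self_mem_nhdsWithin, nhdsWithin_le_nhds hnhds] with p hreg ⟨hpx, hpy, hpz⟩
  exact tripleSum_eq_appellLerchSide hq hq0 hpx hpy hpz hreg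

end HeckeTriple

end

theorem mainTheorem2 (q x y z : ℂ) (hq : q ≠ 0)
    (hqx : ‖q‖ < ‖x‖) (hx : ‖x‖ < 1)
    (hqy : ‖q‖ < ‖y‖) (hy : ‖y‖ < 1)
    (hqz : ‖q‖ < ‖z‖) (hz : ‖z‖ < 1) :
    -- both triple series converge absolutely
    Summable (fun p : HeckeTriple.nonnegTriples => HeckeTriple.term q x y z p) ∧
    Summable (fun p : HeckeTriple.negTriples => HeckeTriple.term q x y z p) ∧
    -- the identity, wherever its right-hand side is defined
    ((x, y, z) ∈ HeckeTriple.regularPoints q →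
      HeckeTriple.tripleSum q x y z = HeckeTriple.appellLerchSide q x y z) ∧
    -- at the removable singularities, the right-hand side is understood as a limit
    Tendsto (fun p : ℂ × ℂ × ℂ => HeckeTriple.appellLerchSide q p.1 p.2.1 p.2.2)
      (𝓝[HeckeTriple.regularPoints q] (x, y, z)) (𝓝 (HeckeTriple.tripleSum q x y z)) := by
  have hq1 : ‖q‖ < 1 := hqx.trans hx
  have hxmem : x ∈ HeckeTriple.annulus ‖q‖ 1 := ⟨hqx, hx⟩
  have hymem : y ∈ HeckeTriple.annulus ‖q‖ 1 := ⟨hqy, hy⟩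
  have hzmem : z ∈ HeckeTriple.annulus ‖q‖ 1 := ⟨hqz, hz⟩
  have hsub := HeckeTriple.annulus_subset_annulus_sq hq1.le
  exact ⟨HeckeTriple.summable_term_nonnegTriples hq1.le hx hy hz,
    HeckeTriple.summable_term_negTriples hq1.le (hsub hxmem).1 (hsub hymem).1 (hsub hzmem).1,
    HeckeTriple.tripleSum_eq_appellLerchSide hq1 hq hxmem hymem hzmem,
    HeckeTriple.tendsto_appellLerchSide hq1 hq hxmem hymem hzmem⟩
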